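/- **Model.** A market has consumers $N=\{1,\dots,n\}$ and suppliers $V=\{1,\dots,m\}$. A system of choice probabilities over a finite set $\mathcal E$ assigns to each menu $S\subseteq\mathcal E$ a probability distribution $f(\cdot,S)$ on $S\cup\{0\}$, where $0$ is the outside option; it is regular if $f(x,S')\le f(x,S)$ whenever $S\subseteq S'$ and $x\in S\cup\{0\}$. Consumer $i$ has a system $p_i$ over $V$, supplier $j$ a system $q_j$ over $N$, and supplier $j$ has a revenue $r_j\ge 0$. The demand function of $j$ is $Q_j(A)=\sum_{i\in A}q_j(i,A)$. Given an assortment family $S=(S_1,\dots,S_n)$, $S_i\subseteq V$, each consumer $i$ independently chooses an element of $S_i\cup\{0\}$ according to $p_i(\cdot,S_i)$; then each supplier $j$ independently chooses an element of $C_j\cup\{0\}$ according to $q_j(\cdot,C_j)$, where $C_j$ is the set of consumers that chose $j$. $\mathbf M_S$ is the sum of $r_j$ over the suppliers $j$ that chose some consumer. $\mathrm{OPT}$ is the maximum of $\mathbb E[\mathbf M_S]$ over the feasible $S$: all families (unconstrained setting), or those with $|S_i|\le K_i$ for all $i$, for given $K\in\mathbb Z_{\ge0}^n$ (cardinality setting).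 Assume that all $p_i$ and $q_j$ are regular, that every consumer is easy-to-match, i.e. $p_i(j,\{j\})\ge p_i(0,\{j\})$ for all $i,j$, and that every $Q_j$ is monotone and submodular. Put $\alpha=(1-e^{-1})/2$. **Theorem.** 1. There is a randomized algorithm (a fixed real-RAM program with fair coin tosses) whose input is $n$, $m$, the revenues, the budgets if there are any, and value oracles for $Q_1,\dots,Q_m$, whose number of steps is always at most a fixed polynomial in $n+m$, and which in both settings always outputs a feasible assortment family $S$ with all $|S_i|\le 1$, and with $|S_i|=1$ whenever consumer $i$ may be shown a singleton, such that $$\mathbb E[\mathbf M_S]\ \ge\ \frac{1-e^{-1}}{2}\cdot\mathrm{OPT},$$ where the expectation is also over the randomization of the algorithm. 2. Let $\mathrm{OPT}_{w}$ be the maximum of the welfare $w(A)=\sum_j r_jQ_j(A_j)$ over the partitions $A=(A_1,\dots,A_m)$ of $N$. Let $F$ be the multilinear extension, on $[0,1]^{N\times V}$, of $B\mapsto\sum_j r_jQ_j(\{i:(i,j)\in B\})$, and let $\mathcal P$ be the convex hull of the indicator vectors of the sets $B\subseteq N\times V$ that contain at most one pair $(i,j)$ for each $i$. A continuous greedy run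 with $T$ steps is a sequence $y_0=0$, $y_{t+1}=y_t+\frac1T z_t$ with $z_t\in\arg\max_{z\in\mathcal P}\langle\nabla F(y_t),z\rangle$. An output of the continuous greedy approach is an assortment family $S_i=\{j: i\in A_j\}$, where $A$ is a partition of $N$ that is a rounding of the final point $y_T$ of such a run ($i\in A_j$ only if $y_T(i,j)>0$) with $w(A)\ge(1-e^{-1})\,\mathrm{OPT}_w$. Every such output is feasible and satisfies $\mathbb E[\mathbf M_S]\ge\alpha\,\mathrm{OPT}$, both in the unconstrained setting and under cardinality constraints with all $K_i\ge1$. 3. The guarantee is tight for this approach. For every $\varepsilon>0$ there is a market satisfying all the assumptions which has, for every $T\ge1$, an output $S$ of the continuous greedy approach with $T$ steps such that $\mathbb E[\mathbf M_S]<(\alpha+\varepsilon)\,\mathrm{OPT}$, simultaneously in the unconstrained setting and for all cardinality constraints with all $K_i\ge1$. With respect to the upper bound $\mathrm{OPT}_w$ on $\mathrm{OPT}$, the guarantee is tight even for roundings that lose nothing: for every $\varepsilon>0$ there is such a market which has, for every $T\ge 1$, an output $S$ from a run with $T$ steps and a partition $A$ with $w(A)\ge F(y_T)$ such that $\mathbb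 E[\mathbf M_S]<(\alpha+\varepsilon)\,\mathrm{OPT}_w$. -/

import Mathlib

open Finset

noncomputable section

/-! ## Choice models -/

/-- A system of choice probabilities over the options `E` and the outside option `none`:
`prob x S` is the probability of choosing `x` when the menu `S` is offered. -/
structure ChoiceSystem (E : Type) [Fintype E] [DecidableEq E] where
  prob : Option E → Finset E → ℝ
  prob_nonneg : ∀ x S, 0 ≤ prob x S
  prob_of_notMem : ∀ e S, e ∉ S → prob (some e) S = 0
  prob_sum : ∀ S, prob none S + ∑ e ∈ S, prob (some e) S = 1

namespace ChoiceSystem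

variable {E : Type} [Fintype E] [DecidableEq E]

/-- The regularity axiom: enlarging the menu does not increase the probability of an option
that was available before (the outside option is always available). -/
def Regular (f : ChoiceSystem E) : Prop :=
  ∀ S S' : Finset E, S ⊆ S' →
    f.prob none S' ≤ f.prob none S ∧ ∀ e ∈ S, f.prob (some e) S' ≤ f.prob (some e) S

/-- The demand function: the probability that some option of the menu is chosen. -/
def demand (f : ChoiceSystem E) (S : Finset E) : ℝ := ∑ e ∈ S, f.prob (some e) S

/-- Facing a single option, the agent is at least as likely to take it as to leave. -/
def EasyToMatch (f : ChoiceSystem E) : Prop :=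
  ∀ e, f.prob none {e} ≤ f.prob (some e) {e}

end ChoiceSystem

/-- Monotonicity of a set function. -/
def SetMonotone {E : Type} (f : Finset E → ℝ) : Prop := ∀ A B, A ⊆ B → f A ≤ f B

/-- Submodularity as diminishing returns. -/
def SetSubmodular {E : Type} [DecidableEq E] (f : Finset E → ℝ) : Prop :=
  ∀ A B, A ⊆ B → ∀ e, e ∉ B → f (insert e B) - f B ≤ f (insert e A) - f A

/-! ## The two-sided sequential market -/

/-- A market with consumers `Fin n` and suppliers `Fin m`: the choice systems of both sides
and the revenues of the suppliers. -/
structure Market (n m : ℕ) where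
  p : Fin n → ChoiceSystem (Fin m)
  q : Fin m → ChoiceSystem (Fin n)
  r : Fin m → ℝ
  r_nonneg : ∀ j, 0 ≤ r j

/-- The two versions of the problem: no constraint, or a budget on the size of each menu. -/
inductive Setting (n : ℕ) where
  | unconstrained : Setting n
  | budget (K : Fin n → ℕ) : Setting n

namespace Setting

variable {n : ℕ}

/-- The menu `A` may be shown to consumer `i`. -/
def Allows {m : ℕ} (C : Setting n) (i : Fin n) (A : Finset (Fin m)) : Prop :=
  match C with
  | unconstrained => True
  | budget K => A.card ≤ K i

/-- `S` is a feasible assortment family. -/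
def Feasible {m : ℕ} (C : Setting n) (S : Fin n → Finset (Fin m)) : Prop :=
  ∀ i, C.Allows i (S i)

end Setting

namespace Market

variable {n m : ℕ}

/-- The consumers who selected supplier `j`, when `c i` is the choice of consumer `i`. -/
def pickers (c : Fin n → Option (Fin m)) (j : Fin m) : Finset (Fin n) :=
  univ.filter fun i => c i = some j

/-- Revenue of the matching when the consumers choose according to `c` and then the suppliers
according to `d`: supplier `j` pays `r j` if it is matched, that is, if it and some consumer
selected each other. -/
def matchingRevenue (I : Market n m) (c : Fin n → Option (Fin m)) (d : Fin m → Option (Fin n)) :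
    ℝ :=
  ∑ j, if ∃ i, d j = some i ∧ c i = some j then I.r j else 0

/-- Probability of the outcome `(c, d)`: consumers choose independently from their menus, then
suppliers choose independently from the consumers who selected them. -/
def outcomeProb (I : Market n m) (S : Fin n → Finset (Fin m))
    (c : Fin n → Option (Fin m)) (d : Fin m → Option (Fin n)) : ℝ :=
  (∏ i, (I.p i).prob (c i) (S i)) * ∏ j, (I.q j).prob (d j) (pickers c j)

/-- The expected revenue of the assortment family `S`. -/
def expectedRevenue (I : Market n m) (S : Fin n → Finset (Fin m)) : ℝ :=
  ∑ c : Fin n → Option (Fin m), ∑ d : Fin m → Option (Fin n),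
    I.outcomeProb S c d * I.matchingRevenue c d

/-- The optimal value (the maximum over the finite nonempty set of feasible families). -/
def opt (I : Market n m) (C : Setting n) : ℝ :=
  sSup (I.expectedRevenue '' {S | C.Feasible S})

/-- The standing assumptions: every agent follows a regular choice model, every consumer is
easy to match, every supplier has a monotone submodular demand function. -/
structure Admissible (I : Market n m) : Prop where
  regular_consumers : ∀ i, (I.p i).Regular
  regular_suppliers : ∀ j, (I.q j).Regular
  easy_consumers : ∀ i, (I.p i).EasyToMatch
  monotone_demand : ∀ j, SetMonotone (I.q j).demand
  submodular_demand : ∀ j, SetSubmodular (I.q j).demand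

/-! ## The submodular welfare bound and the continuous greedy approach -/

/-- The sets `A j` are pairwise disjoint and cover all consumers. -/
def IsPartition (A : Fin m → Finset (Fin n)) : Prop :=
  (∀ j j', j ≠ j' → Disjoint (A j) (A j')) ∧ ∀ i, ∃ j, i ∈ A j

/-- The welfare of a family of sets of consumers. -/
def welfare (I : Market n m) (A : Fin m → Finset (Fin n)) : ℝ :=
  ∑ j, I.r j * (I.q j).demand (A j)

/-- The optimal value of the submodular welfare problem. -/
def welfareOpt (I : Market n m) : ℝ :=
  sSup (I.welfare '' {A | IsPartition A})

/-- The assortment family in which `j` is shown to the consumers of `A j`. -/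
def menusOf (A : Fin m → Finset (Fin n)) (i : Fin n) : Finset (Fin m) :=
  univ.filter fun j => i ∈ A j

/-- The slice of a set of (consumer, supplier) pairs at supplier `j`. -/
def slice (B : Finset (Fin n × Fin m)) (j : Fin m) : Finset (Fin n) :=
  univ.filter fun i => (i, j) ∈ B

/-- Multilinear extension of the welfare, over the ground set of (consumer, supplier) pairs. -/
def multilinear (I : Market n m) (y : Fin n × Fin m → ℝ) : ℝ :=
  ∑ B : Finset (Fin n × Fin m),
    I.welfare (slice B) * ((∏ e ∈ B, y e) * ∏ e ∈ Bᶜ, (1 - y e))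

/-- The partition matroid polytope: the convex hull of the indicator vectors of the sets of
pairs that contain at most one pair for each consumer. -/
def assignmentPolytope (n m : ℕ) : Set (Fin n × Fin m → ℝ) :=
  convexHull ℝ
    {z | ∃ B : Finset (Fin n × Fin m),
      (∀ i : Fin n, (B.filter fun e => e.1 = i).card ≤ 1) ∧
      z = fun e => if e ∈ B then 1 else 0}

/-- `y 0, …, y T` are the iterates of the discretized continuous greedy algorithm with step
`1 / T`: each step goes in a direction of the polytope that maximizes the inner product with the
gradient of the multilinear extension. -/
def IsContinuousGreedyRun (I : Market n m) (T : ℕ) (y : ℕ → Fin n × Fin m → ℝ) : Prop :=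
  y 0 = 0 ∧
  ∀ t < T, ∃ z ∈ assignmentPolytope n m,
    (∀ w ∈ assignmentPolytope n m,
      fderiv ℝ I.multilinear (y t) w ≤ fderiv ℝ I.multilinear (y t) z) ∧
    y (t + 1) = y t + (1 / (T : ℝ)) • z

/-- The partition `A` is a rounding of the fractional assignment `y`: every consumer goes to a
supplier to which `y` assigns a positive fraction of it. -/
def IsRounding (y : Fin n × Fin m → ℝ) (A : Fin m → Finset (Fin n)) : Prop :=
  IsPartition A ∧ ∀ i j, i ∈ A j → 0 < y (i, j)

/-- `A` is a partition obtained from the final point of the continuous greedy run `y` with `T`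
steps by a rounding whose welfare is at least a fraction `1 - 1 / e` of the optimal welfare. The
continuous greedy approach then outputs the assortment family `menusOf A`. -/
def IsGreedyPartition (I : Market n m) (T : ℕ) (y : ℕ → Fin n × Fin m → ℝ)
    (A : Fin m → Finset (Fin n)) : Prop :=
  I.IsContinuousGreedyRun T y ∧ IsRounding (y T) A ∧
    (1 - Real.exp (-1)) * I.welfareOpt ≤ I.welfare A

end Market

/-! ## Randomized real RAM programs with a value oracle and a step count -/

/-- Finite trees of fair coin flips with results in `α` at the leaves. -/
inductive Coin (α : Type) where
  | ret (a : α) : Coin α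
  | flip (heads tails : Coin α) : Coin α

namespace Coin

variable {α β : Type}

/-- Sequential composition. -/
def bind : Coin α → (α → Coin β) → Coin β
  | ret a, k => k a
  | flip h t, k => flip (h.bind k) (t.bind k)

/-- Expected value of `f` over the coin flips. -/
def expect (f : α → ℝ) : Coin α → ℝ
  | ret a => f a
  | flip h t => (h.expect f + t.expect f) / 2

/-- `P` holds for every outcome of the coin flips. -/
def Always (P : α → Prop) : Coin α → Prop
  | ret a => P a
  | flip h t => h.Always P ∧ t.Always P

end Coin

/-- Memory: arrays of natural numbers and arrays of reals, `nat a k` being cell `k` of array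
`a`. -/
structure Memory where
  nat : ℕ → ℕ → ℕ
  real : ℕ → ℕ → ℝ

namespace Memory

/-- Write `v` into cell `k` of the natural number array `a`. -/
def setNat (s : Memory) (a k v : ℕ) : Memory :=
  { s with nat := Function.update s.nat a (Function.update (s.nat a) k v) }

/-- Write `v` into cell `k` of the real array `a`. -/
def setReal (s : Memory) (a k : ℕ) (v : ℝ) : Memory :=
  { s with real := Function.update s.real a (Function.update (s.real a) k v) }

end Memory

/-- Natural number expressions; `read a e` is the cell with index `e` of array `a`. -/
inductive NatExpr where
  | const (c : ℕ)
  | read (a : ℕ) (e : NatExpr)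
  | add (e₁ e₂ : NatExpr)
  | sub (e₁ e₂ : NatExpr)
  | mul (e₁ e₂ : NatExpr)

/-- Value of a natural number expression. -/
def NatExpr.eval (s : Memory) : NatExpr → ℕ
  | const c => c
  | read a e => s.nat a (e.eval s)
  | add e₁ e₂ => e₁.eval s + e₂.eval s
  | sub e₁ e₂ => e₁.eval s - e₂.eval s
  | mul e₁ e₂ => e₁.eval s * e₂.eval s

/-- Real expressions. -/
inductive RealExpr where
  | ofNat (e : NatExpr)
  | read (a : ℕ) (e : NatExpr)
  | add (e₁ e₂ : RealExpr)
  | sub (e₁ e₂ : RealExpr)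
  | mul (e₁ e₂ : RealExpr)

/-- Value of a real expression. -/
def RealExpr.eval (s : Memory) : RealExpr → ℝ
  | ofNat e => (e.eval s : ℝ)
  | read a e => s.real a (e.eval s)
  | add e₁ e₂ => e₁.eval s + e₂.eval s
  | sub e₁ e₂ => e₁.eval s - e₂.eval s
  | mul e₁ e₂ => e₁.eval s * e₂.eval s

/-- Tests. -/
inductive Test where
  | natLe (e₁ e₂ : NatExpr)
  | realLe (e₁ e₂ : RealExpr)

/-- Truth of a test. -/
def Test.Holds (s : Memory) : Test → Prop
  | natLe e₁ e₂ => e₁.eval s ≤ e₂.eval s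
  | realLe e₁ e₂ => e₁.eval s ≤ e₂.eval s

/-- Programs. -/
inductive Program where
  /-- do nothing -/
  | skip
  /-- array `a` of naturals, cell `k`, receives the value of `v` -/
  | setNat (a : ℕ) (k v : NatExpr)
  /-- array `a` of reals, cell `k`, receives the value of `v` -/
  | setReal (a : ℕ) (k : NatExpr) (v : RealExpr)
  /-- array `a` of naturals, cell `k`, receives a fair random bit -/
  | toss (a : ℕ) (k : NatExpr)
  /-- array `a` of reals, cell `k`, receives the oracle's value for supplier `j` and the set of
  consumers whose cells in the array `b` of naturals are nonzero -/
  | query (a : ℕ) (k : NatExpr) (j : NatExpr) (b : ℕ)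
  /-- sequential composition -/
  | seq (P₁ P₂ : Program)
  /-- conditional -/
  | cond (t : Test) (P₁ P₂ : Program)
  /-- run `P` for the values `0, 1, …, b - 1` of cell 0 of the array `x` of naturals, where `b` is
  evaluated once, before the loop -/
  | loop (x : ℕ) (b : NatExpr) (P : Program)

/-- The loop with body `f` and `N` rounds, with its number of steps. -/
def loopRun (x : ℕ) (f : Memory → Coin (Memory × ℕ)) (s : Memory) : ℕ → Coin (Memory × ℕ)
  | 0 => Coin.ret (s, 1)
  | N + 1 => (loopRun x f s N).bind fun r =>
      (f (r.1.setNat x 0 N)).bind fun r' => Coin.ret (r'.1, r.2 + (1 + Nat.size N) + r'.2)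

open Classical in
/-- Execution of a program, with its number of steps. Writing a natural number costs its number
of binary digits plus one; every other elementary command, in particular a real operation, an
oracle query or a coin toss, costs one step. (Expressions have constant size, since the program is
fixed.) -/
def Program.exec {n m : ℕ} (Q : Fin m → Finset (Fin n) → ℝ) :
    Program → Memory → Coin (Memory × ℕ)
  | skip, s => Coin.ret (s, 1)
  | setNat a k v, s => Coin.ret (s.setNat a (k.eval s) (v.eval s), 1 + Nat.size (v.eval s))
  | setReal a k v, s => Coin.ret (s.setReal a (k.eval s) (v.eval s), 1)
  | toss a k, s =>
      Coin.flip (Coin.ret (s.setNat a (k.eval s) 1, 1)) (Coin.ret (s.setNat a (k.eval s) 0, 1))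
  | query a k j b, s =>
      Coin.ret (s.setReal a (k.eval s)
        (if h : j.eval s < m then
          Q ⟨j.eval s, h⟩ (univ.filter fun i : Fin n => s.nat b i ≠ 0) else 0), 1)
  | seq P₁ P₂, s => (P₁.exec Q s).bind fun r =>
      (P₂.exec Q r.1).bind fun r' => Coin.ret (r'.1, r.2 + r'.2)
  | cond t P₁ P₂, s =>
      (if t.Holds s then P₁.exec Q s else P₂.exec Q s).bind fun r => Coin.ret (r.1, r.2 + 1)
  | loop x b P, s => loopRun x (P.exec Q) s (b.eval s)

/-- Initial memory: array 0 of naturals holds `n`, `m` and a flag that tells whether there are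
budgets, array 1 of naturals holds the budgets, array 0 of reals holds the revenues, and all other
cells are zero. -/
def inputMemory {n m : ℕ} (C : Setting n) (r : Fin m → ℝ) : Memory where
  nat a k :=
    if a = 0 then
      (if k = 0 then n else if k = 1 then m else if k = 2 then
        (match C with
        | Setting.unconstrained => 0
        | Setting.budget _ => 1) else 0)
    else if a = 1 then
      (match C with
      | Setting.unconstrained => 0
      | Setting.budget K => if h : k < n then K ⟨k, h⟩ else 0)
    else 0
  real a k := if a = 0 then (if h : k < m then r ⟨k, h⟩ else 0) else 0

/-- The assortment family written in array 2 of naturals: `j` is shown to `i` if and only if cell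
`i * m + j` is nonzero. -/
def outputMenus (n m : ℕ) (s : Memory) (i : Fin n) : Finset (Fin m) :=
  univ.filter fun j => s.nat 2 ((i : ℕ) * m + j) ≠ 0

/-- Run a program on `n`, `m`, the constraints, the revenues and value oracles for the demand
functions (and no other data of the market). The result is the assortment family and the number
of steps. -/
def Program.run {n m : ℕ} (P : Program) (C : Setting n) (r : Fin m → ℝ)
    (Q : Fin m → Finset (Fin n) → ℝ) : Coin ((Fin n → Finset (Fin m)) × ℕ) :=
  (P.exec Q (inputMemory C r)).bind fun o => Coin.ret (outputMenus n m o.1, o.2)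

end

noncomputable section

/-! ## Multilinear extensions of monotone submodular functions -/

section SetFunction

variable {ι : Type} [DecidableEq ι]

/-! Upper bound: given the choices of the consumers, the expected revenue is the welfare of the sets
of pickers. So no family earns more than the best welfare of a possible outcome, and this is at most
OPT_w whenever a partition exists.

Lower bound: the consumers who pick a supplier form a random set with independent inclusions, so the
revenue is a sum of multilinear extensions of demand functions (`Market.expectedRevenue_eq`). A
singleton menu is accepted with probability at least 1/2. For monotone submodular functions,
independent inclusions with probabilities at least ρ are worth at least as much as including the
whole block with probability ρ (`mix_block_le_multilinearExtension`). Hence the menus of a partition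
A earn at least w(A)/2, which proves the guarantee of the continuous greedy approach.

The algorithm is a deterministic greedy instead. Plain greedy would only give 1/2 · 1/2. Split the
consumers of each supplier into k groups and keep or drop each group by a fair coin. By the block
inequality, applied group by group, the sum of the welfare over all sets of groups (`potential`) is
at most 2^k times the revenue. Giving each consumer the supplier and group with the largest
potential yields k 2^k w ≤ (3k+1) · potential for every competing outcome of welfare w
(`welfare_le_potential`). The resulting factor k/(3k+1) tends to 1/3 > (1 - 1/e)/2, and k = 7
suffices. As k is constant, one value of the potential takes 2^7 queries per supplier.

Tightness: let consumer i surely take supplier i, if offered, and accept any other singleton with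
probability 1/2; let a supplier be matched whenever someone picks it. Then OPT = n. By symmetry the
continuous greedy may always move in the uniform direction, ending at the constant 1/n, where F =
n(1 - (1 - 1/n)^n). A partition that occupies about F suppliers and avoids favorites is an
admissible output, and it earns about F/2. -/

theorem SetSubmodular.marginal_le {h : Finset ι → ℝ} (hs : SetSubmodular h) (hm : SetMonotone h)
    {A B : Finset ι} (hAB : A ⊆ B) (e : ι) : h (insert e B) - h B ≤ h (insert e A) - h A := by
  by_cases he : e ∈ B
  · rw [insert_eq_of_mem he, sub_self]
    exact sub_nonneg.2 (hm _ _ (subset_insert e A))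
  · exact hs A B hAB e he

theorem SetMonotone.union_right {h : Finset ι → ℝ} (hm : SetMonotone h) (C : Finset ι) :
    SetMonotone fun B => h (B ∪ C) :=
  fun _ _ hAB => hm _ _ (union_subset_union_left hAB)

theorem SetSubmodular.union_right {h : Finset ι → ℝ} (hs : SetSubmodular h) (hm : SetMonotone h)
    (C : Finset ι) : SetSubmodular fun B => h (B ∪ C) := by
  intro A B hAB e _
  simp only [insert_union]
  exact hs.marginal_le hm (union_subset_union_left hAB) e

end SetFunction

section Labels

variable {ι : Type} [Fintype ι]

/-- The elements whose label is `t + 1` for some `t ∈ T`. -/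
def labelled (col : ι → ℕ) (T : Finset ℕ) : Finset ι := univ.filter fun i => ∃ t ∈ T, col i = t + 1

theorem mem_labelled {col : ι → ℕ} {T : Finset ℕ} {i : ι} :
    i ∈ labelled col T ↔ ∃ t ∈ T, col i = t + 1 := by simp [labelled]

end Labels

section MultilinearExtension

variable {ι : Type} [Fintype ι] [DecidableEq ι]

/-- Probability of the set `B` when each `e` is included independently with probability `y e`. -/
def inclusionWeight (y : ι → ℝ) (B : Finset ι) : ℝ := (∏ e ∈ B, y e) * ∏ e ∈ Bᶜ, (1 - y e)

/-- Expected value of `h` on the random set that includes each `e` independently with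
probability `y e`. -/
def multilinearExtension (h : Finset ι → ℝ) (y : ι → ℝ) : ℝ := ∑ B, h B * inclusionWeight y B

theorem inclusionWeight_nonneg {y : ι → ℝ} (h0 : ∀ e, 0 ≤ y e) (h1 : ∀ e, y e ≤ 1)
    (B : Finset ι) : 0 ≤ inclusionWeight y B :=
  mul_nonneg (prod_nonneg fun e _ => h0 e) (prod_nonneg fun e _ => sub_nonneg.2 (h1 e))

theorem sum_prod_mul_prod_compl (f g : ι → ℝ) :
    ∑ B : Finset ι, (∏ e ∈ B, f e) * ∏ e ∈ Bᶜ, g e = ∏ e, (f e + g e) := by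
  rw [prod_add, powerset_univ]
  exact sum_congr rfl fun B _ => by rw [compl_eq_univ_sdiff]

theorem sum_inclusionWeight (y : ι → ℝ) : ∑ B, inclusionWeight y B = 1 := by
  simp only [inclusionWeight]
  rw [sum_prod_mul_prod_compl]
  simp

theorem multilinearExtension_mono {h h' : Finset ι → ℝ} {y : ι → ℝ} (h0 : ∀ e, 0 ≤ y e)
    (h1 : ∀ e, y e ≤ 1) (hh : ∀ B, h B ≤ h' B) :
    multilinearExtension h y ≤ multilinearExtension h' y :=
  sum_le_sum fun B _ => mul_le_mul_of_nonneg_right (hh B) (inclusionWeight_nonneg h0 h1 B)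

theorem multilinearExtension_const (c : ℝ) (y : ι → ℝ) :
    multilinearExtension (fun _ => c) y = c := by
  rw [multilinearExtension, ← mul_sum, sum_inclusionWeight, mul_one]

theorem multilinearExtension_add (h h' : Finset ι → ℝ) (y : ι → ℝ) :
    multilinearExtension (fun B => h B + h' B) y =
      multilinearExtension h y + multilinearExtension h' y := by
  simp only [multilinearExtension, add_mul, sum_add_distrib]

theorem le_multilinearExtension {h : Finset ι → ℝ} {y : ι → ℝ} (hm : SetMonotone h)
    (h0 : ∀ e, 0 ≤ y e) (h1 : ∀ e, y e ≤ 1) : h ∅ ≤ multilinearExtension h y := by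
  rw [← multilinearExtension_const (h ∅) y]
  exact multilinearExtension_mono h0 h1 fun B => hm _ _ (empty_subset B)

theorem inclusionWeight_of_notMem {y : ι → ℝ} {e : ι} {B : Finset ι} (he : e ∉ B) :
    inclusionWeight y B = (1 - y e) * inclusionWeight (Function.update y e 0) B := by
  have hB : e ∈ Bᶜ := mem_compl.2 he
  rw [inclusionWeight, inclusionWeight, ← mul_prod_erase _ _ hB, ← mul_prod_erase _ _ hB,
    prod_congr rfl fun i hi => (Function.update_of_ne (ne_of_mem_of_not_mem hi he) 0 y).symm,
    prod_congr rfl fun i hi => (congrArg (1 - ·)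
      (Function.update_of_ne (ne_of_mem_erase hi) 0 y)).symm]
  simp
  ring

theorem inclusionWeight_insert {y : ι → ℝ} {e : ι} {B : Finset ι} (he : e ∉ B) :
    inclusionWeight y (insert e B) = y e * inclusionWeight (Function.update y e 0) B := by
  have hB : e ∈ Bᶜ := mem_compl.2 he
  rw [inclusionWeight, inclusionWeight, ← mul_prod_erase _ _ hB, prod_insert he, compl_insert,
    prod_congr rfl fun i hi => (Function.update_of_ne (ne_of_mem_of_not_mem hi he) 0 y).symm,
    prod_congr rfl fun i hi => (congrArg (1 - ·)
      (Function.update_of_ne (ne_of_mem_erase hi) 0 y)).symm]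
  simp
  ring

theorem sum_finset_split (e : ι) (f : Finset ι → ℝ) :
    ∑ B, f B = ∑ B ∈ (univ.erase e).powerset, (f B + f (insert e B)) := by
  rw [← powerset_univ, ← insert_erase (mem_univ e), sum_powerset_insert (notMem_erase _ _),
    erase_insert (notMem_erase _ _), sum_add_distrib]

theorem notMem_of_mem_powerset_erase {e : ι} {B : Finset ι}
    (hB : B ∈ ((univ : Finset ι).erase e).powerset) : e ∉ B :=
  fun h => notMem_erase e univ (mem_powerset.1 hB h)

/-- Conditioning on the inclusion of one element. -/
theorem multilinearExtension_split (h : Finset ι → ℝ) (y : ι → ℝ) (e : ι) :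
    multilinearExtension h y = (1 - y e) * multilinearExtension h (Function.update y e 0) +
      y e * multilinearExtension (fun B => h (insert e B)) (Function.update y e 0) := by
  simp only [multilinearExtension]
  rw [sum_finset_split e, sum_finset_split e, sum_finset_split e, mul_sum, mul_sum,
    ← sum_add_distrib]
  refine sum_congr rfl fun B hB => ?_
  have he := notMem_of_mem_powerset_erase hB
  rw [inclusionWeight_of_notMem he, inclusionWeight_insert he,
    inclusionWeight_insert (y := Function.update y e 0) he]
  simp
  ring

/-- Including a whole block `B` with probability `ρ` is no better than including its elements
independently, each with probability at least `ρ`. -/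
theorem mix_block_le_multilinearExtension {ρ : ℝ} (hρ0 : 0 ≤ ρ) (hρ1 : ρ ≤ 1) (B : Finset ι)
    {h : Finset ι → ℝ} (hm : SetMonotone h) (hs : SetSubmodular h) {y : ι → ℝ}
    (h0 : ∀ e, 0 ≤ y e) (h1 : ∀ e, y e ≤ 1) (hB : ∀ e ∈ B, ρ ≤ y e) :
    (1 - ρ) * multilinearExtension h (fun e => if e ∈ B then 0 else y e) +
      ρ * multilinearExtension (fun R => h (R ∪ B)) (fun e => if e ∈ B then 0 else y e) ≤
    multilinearExtension h y := by
  induction B using Finset.induction_on generalizing h y with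
  | empty => simp only [notMem_empty, if_false, union_empty]; linarith
  | insert e B he ih =>
    set y' := Function.update y e 0 with hy'
    have hy0 : ∀ i, 0 ≤ y' i := fun i => by
      by_cases hi : i = e
      · simp [hy', hi]
      · simpa [hy', hi] using h0 i
    have hy1 : ∀ i, y' i ≤ 1 := fun i => by
      by_cases hi : i = e
      · simp [hy', hi]
      · simpa [hy', hi] using h1 i
    have hyB : ∀ i ∈ B, ρ ≤ y' i := fun i hi => by
      have hne : i ≠ e := ne_of_mem_of_not_mem hi he
      simpa [hy', hne] using hB i (mem_insert_of_mem hi)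
    have hye : (fun i => if i ∈ insert e B then 0 else y i) =
        fun i => if i ∈ B then 0 else y' i := by
      ext i
      by_cases hi : i = e
      · simp [hy', hi]
      · simp [hy', hi, mem_insert]
    set y'' : ι → ℝ := fun i => if i ∈ B then 0 else y' i with hy''
    have hz0 : ∀ i, 0 ≤ y'' i := fun i => by
      simp only [hy'']; split_ifs <;> simp [hy0]
    have hz1 : ∀ i, y'' i ≤ 1 := fun i => by
      simp only [hy'']; split_ifs <;> simp [hy1]
    have hins : (fun R : Finset ι => h (insert e R)) = fun R => h (R ∪ {e}) := by
      ext R; rw [union_comm, ← insert_eq]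
    have ih1 := ih hm hs hy0 hy1 hyB
    have ih2 := ih (hm.union_right {e}) (hs.union_right hm {e}) hy0 hy1 hyB
    have hsplit := multilinearExtension_split h y e
    rw [hins] at hsplit
    have hle : multilinearExtension h y' ≤ multilinearExtension (fun R => h (R ∪ {e})) y' :=
      multilinearExtension_mono hy0 hy1 fun R => hm _ _ subset_union_left
    have hpt : multilinearExtension (fun R => h R + h (R ∪ insert e B)) y'' ≤
        multilinearExtension (fun R => h (R ∪ B) + h (R ∪ {e})) y'' := by
      refine multilinearExtension_mono hz0 hz1 fun R => ?_
      -- That is, h(R) + h(R ∪ B ∪ {e}) ≤ h(R ∪ B) + h(R ∪ {e}): including exactly one of `B` and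
      -- `e` is on average at least as good as including none or both.
      have := hs.marginal_le hm (subset_union_left (s₁ := R) (s₂ := B)) e
      rw [union_insert, union_comm R {e}, ← insert_eq]
      linarith
    rw [multilinearExtension_add, multilinearExtension_add] at hpt
    rw [hye]
    have hpe := hB e (mem_insert_self e B)
    have hun : (fun R : Finset ι => h (R ∪ B ∪ {e})) = fun R => h (R ∪ insert e B) := by
      ext R; congr 1; ext i; simp
    rw [hun] at ih2
    rw [hsplit]
    -- Monotonicity allows `y e` to be lowered to ρ. The two induction hypotheses then give four
    -- terms with weights (1-ρ)², ρ(1-ρ), ρ(1-ρ), ρ², and `hpt` replaces the two mixed ones.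
    nlinarith [mul_le_mul_of_nonneg_left ih1 (sub_nonneg.2 hρ1),
      mul_le_mul_of_nonneg_left ih2 hρ0, mul_nonneg (sub_nonneg.2 hpe) (sub_nonneg.2 hle),
      mul_le_mul_of_nonneg_left hpt (mul_nonneg hρ0 (sub_nonneg.2 hρ1))]

/-- Including each of `k` groups as a block with probability one half is no better than including
their elements independently, each with probability at least one half. -/
theorem sum_labelled_le_multilinearExtension (col : ι → ℕ) (k : ℕ)
    {h : Finset ι → ℝ} (hm : SetMonotone h) (hs : SetSubmodular h) {y : ι → ℝ}
    (h0 : ∀ e, 0 ≤ y e) (h1 : ∀ e, y e ≤ 1)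
    (hy : ∀ e, col e ≠ 0 → col e ≤ k → 1 / 2 ≤ y e) :
    ∑ T ∈ (range k).powerset, h (labelled col T) ≤ 2 ^ k * multilinearExtension h y := by
  induction k generalizing h y with
  | zero =>
    have : labelled col ∅ = ∅ := by ext; simp [labelled]
    simpa [this] using le_multilinearExtension hm h0 h1
  | succ k ih =>
    set B : Finset ι := univ.filter fun i => col i = k + 1 with hBdef
    set y' : ι → ℝ := fun e => if e ∈ B then 0 else y e with hy'
    have hz0 : ∀ i, 0 ≤ y' i := fun i => by
      simp only [hy']; split_ifs <;> simp [h0]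
    have hz1 : ∀ i, y' i ≤ 1 := fun i => by
      simp only [hy']; split_ifs <;> simp [h1]
    have hz : ∀ e, col e ≠ 0 → col e ≤ k → 1 / 2 ≤ y' e := fun e he hk => by
      have : e ∉ B := by simp [hBdef]; omega
      simpa [hy', this] using hy e he (by omega)
    -- The last group is split off as a block; the induction hypothesis applies to `h` and to `h (·
    -- ∪ B)`.
    have hmix := mix_block_le_multilinearExtension (ρ := 1 / 2) (by norm_num) (by norm_num) B
      hm hs h0 h1 fun e he => by
        have : col e = k + 1 := by simpa [hBdef] using he
        exact hy e (by omega) this.le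
    have ih1 := ih hm hs hz0 hz1 hz
    have ih2 := ih (hm.union_right B) (hs.union_right hm B) hz0 hz1 hz
    rw [range_add_one, sum_powerset_insert (by simp), pow_succ]
    have hl : ∀ T : Finset ℕ, labelled col (insert k T) = labelled col T ∪ B := fun T => by
      ext i
      simp only [mem_labelled, mem_union, hBdef, mem_filter, mem_univ, true_and, mem_insert,
        exists_eq_or_imp]
      exact or_comm
    simp only [hl]
    have h2 : (0 : ℝ) < 2 ^ k := by positivity
    nlinarith [mul_le_mul_of_nonneg_left hmix h2.le]

end MultilinearExtension

/-! ## The expected revenue -/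

/-- Under a product law, a function of one coordinate only sees the law of that coordinate: the
other factors sum to one. -/
theorem sum_prod_mul_apply {α β : Type} [Fintype α] [DecidableEq α] [Fintype β]
    (f : α → β → ℝ) (a₀ : α) (hf : ∀ a, ∑ x, f a x = 1) (g : β → ℝ) :
    ∑ d : α → β, (∏ a, f a (d a)) * g (d a₀) = ∑ x, f a₀ x * g x := by
  classical
  have h := prod_univ_sum (fun _ : α => (univ : Finset β))
    fun a x => f a x * if a = a₀ then g x else 1
  rw [Fintype.piFinset_univ] at h
  calc _ = ∑ d : α → β, ∏ a, (f a (d a) * if a = a₀ then g (d a) else 1) := by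
        refine sum_congr rfl fun d _ => ?_
        rw [prod_mul_distrib, prod_ite_eq' univ a₀ fun a => g (d a)]
        simp
    _ = _ := by
        rw [← h, ← mul_prod_erase _ _ (mem_univ a₀)]
        rw [prod_eq_one (s := univ.erase a₀), mul_one]
        · simp
        · intro a ha
          simp [ne_of_mem_erase ha, hf]

namespace ChoiceSystem

variable {E : Type} [Fintype E] [DecidableEq E] (f : ChoiceSystem E)

theorem sum_prob (S : Finset E) : ∑ x, f.prob x S = 1 := by
  rw [Fintype.sum_option, ← f.prob_sum S]
  congr 1
  exact (sum_subset (subset_univ S) fun e _ he => f.prob_of_notMem e S he).symm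

theorem prob_le_one (x : Option E) (S : Finset E) : f.prob x S ≤ 1 := by
  rw [← f.sum_prob S]
  exact single_le_sum (fun y _ => f.prob_nonneg y S) (mem_univ x)

theorem demand_nonneg (S : Finset E) : 0 ≤ f.demand S := sum_nonneg fun _ _ => f.prob_nonneg _ _

theorem demand_empty : f.demand ∅ = 0 := by simp [demand]

theorem sum_prob_mul_ite (S : Finset E) (r : ℝ) :
    ∑ x, f.prob x S * (if ∃ e, x = some e ∧ e ∈ S then r else 0) = r * f.demand S := by
  rw [Fintype.sum_option, demand, mul_sum]
  simp only [reduceCtorEq, false_and, exists_false, if_false, mul_zero, zero_add,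
    Option.some.injEq, exists_eq_left', mul_ite]
  rw [sum_ite_mem, univ_inter]
  exact sum_congr rfl fun e _ => mul_comm _ _

theorem half_le_of_easyToMatch {f : ChoiceSystem E} (hf : f.EasyToMatch) (e : E) :
    1 / 2 ≤ f.prob (some e) {e} := by
  have h1 := f.prob_sum {e}
  have h2 := hf e
  rw [sum_singleton] at h1
  linarith

end ChoiceSystem

namespace Market

variable {n m : ℕ} (I : Market n m)

/-- Given `c`, the term of supplier `j` depends on `d` only through `d j`, so the law of `d j` alone
gives the demand at the set of pickers. -/
theorem expectedRevenue_eq_sum (S : Fin n → Finset (Fin m)) :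
    I.expectedRevenue S =
      ∑ c : Fin n → Option (Fin m), (∏ i, (I.p i).prob (c i) (S i)) * I.welfare (pickers c) := by
  refine sum_congr rfl fun c _ => ?_
  simp only [outcomeProb, matchingRevenue, welfare, mul_assoc, ← mul_sum]
  congr 1
  simp only [mul_sum]
  rw [sum_comm]
  refine sum_congr rfl fun j _ => ?_
  have := sum_prod_mul_apply (fun j x => (I.q j).prob x (pickers c j)) j
    (fun j => (I.q j).sum_prob _) fun x => if ∃ i, x = some i ∧ i ∈ pickers c j then I.r j else 0
  refine (sum_congr rfl fun d _ => ?_).trans (this.trans ?_)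
  · simp [pickers]
  · rw [← (I.q j).sum_prob_mul_ite]
    exact sum_congr rfl fun x _ => by congr

/-- The consumers who select `j` form a random set with independent inclusions. -/
theorem sum_prod_prob_mul_pickers (S : Fin n → Finset (Fin m)) (j : Fin m)
    (h : Finset (Fin n) → ℝ) :
    ∑ c : Fin n → Option (Fin m), (∏ i, (I.p i).prob (c i) (S i)) * h (pickers c j) =
      multilinearExtension h fun i => (I.p i).prob (some j) (S i) := by
  rw [← sum_fiberwise_of_maps_to (t := univ) (g := fun c => pickers c j) fun _ _ => mem_univ _]
  refine sum_congr rfl fun B _ => ?_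
  -- The event is a product event: the consumers in `B` choose `j`, each other one chooses anything
  -- else.
  have hfib : (univ.filter fun c : Fin n → Option (Fin m) => pickers c j = B) =
      Fintype.piFinset fun i => if i ∈ B then {some j} else univ.erase (some j) := by
    ext c
    simp only [mem_filter, mem_univ, true_and, Fintype.mem_piFinset, Finset.ext_iff (s₂ := B),
      pickers]
    refine forall_congr' fun i => ?_
    by_cases hi : i ∈ B <;> simp [hi]
  calc _ = h B * ∑ c ∈ univ.filter fun c => pickers c j = B,
        ∏ i, (I.p i).prob (c i) (S i) := by
        rw [mul_sum]
        refine sum_congr rfl fun c hc => ?_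
        rw [(mem_filter.1 hc).2, mul_comm]
    _ = _ := by
        rw [hfib, ← prod_univ_sum _ fun i x => (I.p i).prob x (S i)]
        congr 1
        rw [inclusionWeight, ← prod_mul_prod_compl B]
        congr 1
        · exact prod_congr rfl fun i hi => by simp [hi]
        · refine prod_congr rfl fun i hi => ?_
          rw [if_neg (mem_compl.1 hi), ← (I.p i).sum_prob (S i),
            ← add_sum_erase _ _ (mem_univ (some j)), add_sub_cancel_left]

theorem expectedRevenue_eq (S : Fin n → Finset (Fin m)) :
    I.expectedRevenue S = ∑ j, I.r j *
      multilinearExtension (I.q j).demand fun i => (I.p i).prob (some j) (S i) := by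
  rw [expectedRevenue_eq_sum]
  simp only [welfare, mul_sum]
  rw [sum_comm]
  refine sum_congr rfl fun j _ => ?_
  rw [← sum_prod_prob_mul_pickers, mul_sum]
  exact sum_congr rfl fun c _ => by ring

theorem welfare_nonneg (A : Fin m → Finset (Fin n)) : 0 ≤ I.welfare A :=
  sum_nonneg fun j _ => mul_nonneg (I.r_nonneg j) ((I.q j).demand_nonneg _)

/-- The expected revenue is at most the welfare of the best possible outcome of the choices. -/
theorem expectedRevenue_le {S : Fin n → Finset (Fin m)} {W : ℝ}
    (hW : ∀ c : Fin n → Option (Fin m), (∀ i j, c i = some j → j ∈ S i) →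
      I.welfare (pickers c) ≤ W) : I.expectedRevenue S ≤ W := by
  rw [expectedRevenue_eq_sum]
  have hone : ∑ c : Fin n → Option (Fin m), ∏ i, (I.p i).prob (c i) (S i) = 1 := by
    have := prod_univ_sum (fun _ : Fin n => (univ : Finset (Option (Fin m))))
      fun i x => (I.p i).prob x (S i)
    rw [Fintype.piFinset_univ] at this
    rw [← this]
    exact prod_eq_one fun i _ => (I.p i).sum_prob _
  calc _ ≤ ∑ c : Fin n → Option (Fin m), (∏ i, (I.p i).prob (c i) (S i)) * W := by
        refine sum_le_sum fun c _ => ?_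
        by_cases hc : ∀ i j, c i = some j → j ∈ S i
        · exact mul_le_mul_of_nonneg_left (hW c hc)
            (prod_nonneg fun i _ => (I.p i).prob_nonneg _ _)
        -- An outcome with a choice outside of the menu has probability zero.
        · push Not at hc
          obtain ⟨i, j, hij, hj⟩ := hc
          rw [prod_eq_zero (mem_univ i) (by rw [hij]; exact (I.p i).prob_of_notMem j _ hj)]
          simp
    _ = W := by rw [← sum_mul, hone, one_mul]

theorem feasible_empty (C : Setting n) : C.Feasible fun _ => (∅ : Finset (Fin m)) := by
  intro i
  cases C <;> simp [Setting.Allows]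

theorem opt_le {C : Setting n} {W : ℝ}
    (hW : ∀ S, C.Feasible S → I.expectedRevenue S ≤ W) : I.opt C ≤ W :=
  csSup_le (Set.Nonempty.image _ ⟨_, feasible_empty C⟩) (by
    rintro _ ⟨S, hS, rfl⟩; exact hW S hS)

theorem le_opt {C : Setting n} {S : Fin n → Finset (Fin m)} (hS : C.Feasible S) :
    I.expectedRevenue S ≤ I.opt C :=
  le_csSup (Set.toFinite _).bddAbove ⟨S, hS, rfl⟩

theorem welfare_le_welfareOpt {A : Fin m → Finset (Fin n)} (hA : IsPartition A) :
    I.welfare A ≤ I.welfareOpt :=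
  le_csSup (Set.toFinite _).bddAbove ⟨A, hA, rfl⟩

/-- `0 ≤ W` covers markets without any partition, where the supremum of the empty set is zero. -/
theorem welfareOpt_le {W : ℝ} (h0 : 0 ≤ W) (hW : ∀ A, IsPartition A → I.welfare A ≤ W) :
    I.welfareOpt ≤ W :=
  Real.sSup_le (by rintro _ ⟨A, hA, rfl⟩; exact hW A hA) h0

variable {I}

/-- Every outcome extends to a partition: consumers who chose the outside option go to their part of
`A`. By monotonicity this does not lower any demand. -/
theorem opt_le_welfareOpt (hI : I.Admissible) {A : Fin m → Finset (Fin n)} (hA : IsPartition A)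
    (C : Setting n) : I.opt C ≤ I.welfareOpt := by
  refine I.opt_le fun S _ => I.expectedRevenue_le fun c _ => ?_
  choose a ha using hA.2
  set B : Fin m → Finset (Fin n) := fun j => univ.filter fun i => (c i).getD (a i) = j with hB
  have hBp : IsPartition B := by
    refine ⟨fun j j' hjj' => ?_, fun i => ⟨(c i).getD (a i), by simp [hB]⟩⟩
    rw [Finset.disjoint_left]
    intro i hi hi'
    simp only [hB, mem_filter, mem_univ, true_and] at hi hi'
    exact hjj' (hi.symm.trans hi')
  refine le_trans (sum_le_sum fun j _ => ?_) (I.welfare_le_welfareOpt hBp)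
  refine mul_le_mul_of_nonneg_left (hI.monotone_demand j _ _ fun i hi => ?_) (I.r_nonneg j)
  simp only [pickers, mem_filter, mem_univ, true_and] at hi
  simp [hB, hi]

theorem menusOf_eq_singleton {A : Fin m → Finset (Fin n)} (hA : IsPartition A) {i : Fin n}
    {j : Fin m} (hij : i ∈ A j) : menusOf A i = {j} := by
  ext j'
  simp only [menusOf, mem_filter, mem_univ, true_and, mem_singleton]
  refine ⟨fun h => ?_, fun h => h ▸ hij⟩
  by_contra hne
  exact Finset.disjoint_left.1 (hA.1 j' j hne) h hij

/-- Showing singleton menus with labels from `k` groups. -/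
theorem sum_labelled_le_expectedRevenue (hI : I.Admissible) (k : ℕ) (ℓ : Fin n → Fin m → ℕ)
    (S : Fin n → Finset (Fin m)) (hS : ∀ i j, ℓ i j ≠ 0 → S i = {j}) :
    ∑ j, I.r j * ∑ T ∈ (range k).powerset, (I.q j).demand (labelled (ℓ · j) T) ≤
      2 ^ k * I.expectedRevenue S := by
  rw [expectedRevenue_eq, mul_sum]
  refine sum_le_sum fun j _ => ?_
  have := sum_labelled_le_multilinearExtension (ℓ · j) k (hI.monotone_demand j)
    (hI.submodular_demand j) (fun i => (I.p i).prob_nonneg (some j) (S i))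
    (fun i => (I.p i).prob_le_one (some j) (S i)) fun i hi _ => by
      rw [hS i j hi]
      exact ChoiceSystem.half_le_of_easyToMatch (hI.easy_consumers i) j
  calc _ ≤ _ := mul_le_mul_of_nonneg_left this (I.r_nonneg j)
    _ = _ := by ring

/-- Showing each consumer its part of a partition yields half of the welfare. -/
theorem welfare_le_two_mul_expectedRevenue (hI : I.Admissible) {A : Fin m → Finset (Fin n)}
    (hA : IsPartition A) : I.welfare A ≤ 2 * I.expectedRevenue (menusOf A) := by
  -- One group only: its two sets of groups contribute the demands at `∅` and at `A j`.
  have h := sum_labelled_le_expectedRevenue hI 1 (fun i j => if i ∈ A j then 1 else 0)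
    (menusOf A) fun i j hij => menusOf_eq_singleton hA (by by_contra h; simp [h] at hij)
  rw [pow_one] at h
  refine le_trans (sum_le_sum fun j _ => mul_le_mul_of_nonneg_left ?_ (I.r_nonneg j)) h
  have hl : labelled (fun i => if i ∈ A j then 1 else 0) {0} = A j := by
    ext i; simp [mem_labelled]
  have := (I.q j).demand_nonneg (labelled (fun i => if i ∈ A j then 1 else 0) ∅)
  rw [range_one, show ({0} : Finset ℕ).powerset = {∅, {0}} from rfl, sum_pair (by simp), hl]
  linarith

theorem greedyPartition_guarantee (hI : I.Admissible) {A : Fin m → Finset (Fin n)}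
    (hA : IsPartition A) (hw : (1 - Real.exp (-1)) * I.welfareOpt ≤ I.welfare A) (C : Setting n)
    (hC : ∀ i (j : Fin m), C.Allows i {j}) :
    C.Feasible (menusOf A) ∧
      (1 - Real.exp (-1)) / 2 * I.opt C ≤ I.expectedRevenue (menusOf A) := by
  refine ⟨fun i => ?_, ?_⟩
  · obtain ⟨j, hj⟩ := hA.2 i
    rw [menusOf_eq_singleton hA hj]
    exact hC i j
  · have h1 := opt_le_welfareOpt hI hA C
    have h2 := welfare_le_two_mul_expectedRevenue hI hA
    have h3 : 0 < 1 - Real.exp (-1) := by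
      have := Real.exp_lt_one_iff.2 (show (-1 : ℝ) < 0 by norm_num)
      linarith
    nlinarith [mul_le_mul_of_nonneg_left h1 h3.le]

end Market

/-! ## The greedy algorithm with groups -/

section SetFunction

variable {ι : Type} [DecidableEq ι] {h : Finset ι → ℝ}

theorem SetSubmodular.union_marginal_le (hs : SetSubmodular h) (hm : SetMonotone h)
    {A B : Finset ι} (hAB : A ⊆ B) (C : Finset ι) : h (B ∪ C) - h B ≤ h (A ∪ C) - h A := by
  induction C using Finset.induction_on with
  | empty => simp
  | insert e C _ ih =>
    have := hs.marginal_le hm (union_subset_union_left (t := C) hAB) e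
    rw [union_insert, union_insert]
    linarith

theorem SetSubmodular.sub_le_sum_marginal (hs : SetSubmodular h) (hm : SetMonotone h)
    (B O : Finset ι) : h O - h B ≤ ∑ e ∈ O, (h (insert e B) - h B) := by
  suffices hsum : h (O ∪ B) - h B ≤ ∑ e ∈ O, (h (insert e B) - h B) by
    have := hm _ _ (subset_union_left (s₁ := O) (s₂ := B))
    linarith
  induction O using Finset.induction_on with
  | empty => simp
  | insert e O he ih =>
    rw [sum_insert he, insert_union]
    have := hs.marginal_le hm (subset_union_right (s₁ := O) (s₂ := B)) e
    linarith

/-- The loss from erasing `t` from all of `T` is at most the increment of `t` when `T` is built up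
element by element, and these increments telescope. -/
theorem SetSubmodular.sum_sub_erase_le (hs : SetSubmodular h) (T : Finset ι) :
    ∑ t ∈ T, (h T - h (T.erase t)) ≤ h T - h ∅ := by
  induction T using Finset.induction_on with
  | empty => simp
  | insert e T he ih =>
    rw [sum_insert he, erase_insert he]
    have : ∑ t ∈ T, (h (insert e T) - h ((insert e T).erase t)) ≤
        ∑ t ∈ T, (h T - h (T.erase t)) := by
      refine sum_le_sum fun t ht => ?_
      have hne : t ≠ e := ne_of_mem_of_not_mem ht he
      have := hs (T.erase t) (insert e (T.erase t)) (subset_insert _ _) t (by simp [hne])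
      rwa [insert_comm, insert_erase ht, ← erase_insert_of_ne hne.symm] at this
    linarith

/-- Double counting: `T` arises by erasing one element in as many ways as there are elements of `U \
T`. -/
theorem sum_powerset_sum_erase (U : Finset ι) (f : Finset ι → ℝ) :
    ∑ T ∈ U.powerset, ∑ t ∈ T, f (T.erase t) = ∑ T ∈ U.powerset, ((#U : ℝ) - #T) * f T := by
  have hcard : ∀ T ∈ U.powerset, ((#U : ℝ) - #T) * f T = ∑ _t ∈ U \ T, f T := fun T hT => by
    rw [sum_const, nsmul_eq_mul, card_sdiff_of_subset (mem_powerset.1 hT),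
      Nat.cast_sub (card_le_card (mem_powerset.1 hT))]
  rw [sum_congr rfl hcard, sum_sigma', sum_sigma']
  refine sum_nbij' (fun p => ⟨p.1.erase p.2, p.2⟩) (fun p => ⟨insert p.2 p.1, p.2⟩) ?_ ?_ ?_ ?_ ?_
  · rintro ⟨T, t⟩ h
    simp only [mem_sigma, mem_powerset, mem_sdiff] at h ⊢
    exact ⟨(erase_subset _ _).trans h.1, h.1 h.2, notMem_erase _ _⟩
  · rintro ⟨T, t⟩ h
    simp only [mem_sigma, mem_powerset, mem_sdiff] at h ⊢
    exact ⟨insert_subset h.2.1 h.1, mem_insert_self _ _⟩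
  · rintro ⟨T, t⟩ h
    simp only [mem_sigma] at h
    simp [insert_erase h.2]
  · rintro ⟨T, t⟩ h
    simp only [mem_sigma, mem_sdiff] at h
    simp [erase_insert h.2.2]
  · rintro ⟨T, t⟩ h
    rfl

theorem two_mul_sum_card (U : Finset ι) :
    2 * ∑ T ∈ U.powerset, (#T : ℝ) = #U * 2 ^ #U := by
  have h := sum_powerset_sum_erase U fun _ => (1 : ℝ)
  simp only [sum_const, nsmul_eq_mul, mul_one, sum_sub_distrib, card_powerset] at h
  push_cast at h
  linarith

/-- Sum `sum_sub_erase_le` over `T` and count the erased sets. The meaning: weighting the sets by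
`h` raises the mean of `#T` from `#U / 2` to at most `(#U + 1) / 2`. -/
theorem SetSubmodular.two_mul_sum_card_mul_le (hs : SetSubmodular h) (h0 : 0 ≤ h ∅)
    (U : Finset ι) :
    2 * ∑ T ∈ U.powerset, #T * h T ≤ (#U + 1) * ∑ T ∈ U.powerset, h T := by
  have h1 : ∑ T ∈ U.powerset, ∑ t ∈ T, (h T - h (T.erase t)) ≤ ∑ T ∈ U.powerset, h T :=
    sum_le_sum fun T _ => (hs.sum_sub_erase_le T).trans (by linarith)
  simp only [sum_sub_distrib, sum_const, nsmul_eq_mul] at h1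
  rw [sum_powerset_sum_erase] at h1
  simp only [sub_mul, sum_sub_distrib, ← mul_sum] at h1
  linarith

end SetFunction

section Labels

variable {ι : Type} [Fintype ι]

theorem labelled_insert [DecidableEq ι] (col : ι → ℕ) (t : ℕ) (T : Finset ℕ) :
    labelled col (insert t T) = labelled col T ∪ labelled col {t} := by
  ext i
  simp only [mem_labelled, mem_union, mem_insert, exists_eq_or_imp, mem_singleton,
    exists_eq_left]
  exact or_comm

theorem labelled_mono (col : ι → ℕ) {T T' : Finset ℕ} (hT : T ⊆ T') :
    labelled col T ⊆ labelled col T' := fun i => by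
  rw [mem_labelled, mem_labelled]
  rintro ⟨t, ht, h⟩
  exact ⟨t, hT ht, h⟩

/-- Groups behave like single elements, so `two_mul_sum_card_mul_le` can be applied to the ground
set of groups. -/
theorem SetSubmodular.labelled [DecidableEq ι] {h : Finset ι → ℝ} (hs : SetSubmodular h) (hm : SetMonotone h) (col : ι → ℕ) :
    SetSubmodular fun T => h (labelled col T) := by
  intro A B hAB t _
  simp only [labelled_insert]
  exact hs.union_marginal_le hm (labelled_mono col hAB) _

end Labels

/-! ### The grouped greedy assignment and its factor k / (3k + 1) -/

section Greedy

variable {n m : ℕ}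

/-- Total welfare, over all sets of groups, of the labelling in which consumer `i` is assigned to
supplier `j` and group `t` when `ℓ i j = t + 1`. -/
def potential (k : ℕ) (r : Fin m → ℝ) (Q : Fin m → Finset (Fin n) → ℝ)
    (ℓ : Fin n → Fin m → ℕ) : ℝ :=
  ∑ j, r j * ∑ T ∈ (range k).powerset, Q j (labelled (ℓ · j) T)

/-- The labelling restricted to the first `N` consumers. -/
def truncate (ℓ : Fin n → Fin m → ℕ) (N : ℕ) : Fin n → Fin m → ℕ :=
  fun i j => if (i : ℕ) < N then ℓ i j else 0

/-- Consumer `i` was assigned to the supplier and group that maximize the potential, given the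
assignments of the previous consumers. -/
def IsGreedyRow (k : ℕ) (r : Fin m → ℝ) (Q : Fin m → Finset (Fin n) → ℝ)
    (ℓ : Fin n → Fin m → ℕ) (i : Fin n) : Prop :=
  ∃ j t, t < k ∧ ℓ i = Pi.single j (t + 1) ∧
    ∀ j' t', t' < k →
      potential k r Q (Function.update (truncate ℓ i) i (Pi.single j' (t' + 1))) ≤
        potential k r Q (Function.update (truncate ℓ i) i (Pi.single j (t + 1)))

theorem truncate_succ (ℓ : Fin n → Fin m → ℕ) (i : Fin n) :
    truncate ℓ (i + 1) = Function.update (truncate ℓ i) i (ℓ i) := by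
  funext i' j
  by_cases hi : i' = i
  · subst hi; simp [truncate]
  · have : (i' : ℕ) ≠ i := fun h => hi (Fin.ext h)
    rw [Function.update_of_ne hi]
    simp only [truncate]
    congr 1
    simp only [eq_iff_iff]
    omega

theorem truncate_of_le (ℓ : Fin n → Fin m → ℕ) {N : ℕ} (hN : n ≤ N) : truncate ℓ N = ℓ := by
  funext i j
  simp [truncate, i.2.trans_le hN]

theorem labelled_truncate_subset (ℓ : Fin n → Fin m → ℕ) {N N' : ℕ} (hN : N ≤ N') (j : Fin m)
    (T : Finset ℕ) : labelled (truncate ℓ N · j) T ⊆ labelled (truncate ℓ N' · j) T := by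
  intro i
  simp only [mem_labelled, truncate]
  rintro ⟨t, ht, h⟩
  have hi : (i : ℕ) < N := by by_contra hi; simp [hi] at h
  exact ⟨t, ht, by rw [if_pos (hi.trans_le hN)]; rwa [if_pos hi] at h⟩

/-- Only supplier `j` is affected, and there only the sets of groups that contain `t`. -/
theorem potential_update (k : ℕ) (r : Fin m → ℝ) (Q : Fin m → Finset (Fin n) → ℝ)
    {ℓ : Fin n → Fin m → ℕ} {i : Fin n} (hi : ℓ i = 0) (j : Fin m) (t : ℕ) :
    potential k r Q (Function.update ℓ i (Pi.single j (t + 1))) = potential k r Q ℓ +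
      r j * ∑ T ∈ (range k).powerset, if t ∈ T then
        Q j (insert i (labelled (ℓ · j) T)) - Q j (labelled (ℓ · j) T) else 0 := by
  have hne : ∀ j' ≠ j, (fun i' => Function.update ℓ i (Pi.single j (t + 1)) i' j') =
      fun i' => ℓ i' j' := fun j' hj' => by
    funext i'
    by_cases h : i' = i
    · subst h; simp [hj', hi]
    · rw [Function.update_of_ne h]
  have heq : ∀ T, labelled (fun i' => Function.update ℓ i (Pi.single j (t + 1)) i' j) T =
      if t ∈ T then insert i (labelled (ℓ · j) T) else labelled (ℓ · j) T := fun T => by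
    ext i'
    by_cases h : i' = i
    · subst h
      split_ifs with ht <;> simp [mem_labelled, ht, hi]
    · split_ifs with ht <;> simp [mem_labelled, h]
  have hrest : ∑ j' ∈ univ.erase j, r j' * ∑ T ∈ (range k).powerset,
      Q j' (labelled (fun i' => Function.update ℓ i (Pi.single j (t + 1)) i' j') T) =
      ∑ j' ∈ univ.erase j, r j' * ∑ T ∈ (range k).powerset, Q j' (labelled (ℓ · j') T) :=
    sum_congr rfl fun j' hj' => by rw [hne j' (ne_of_mem_erase hj')]
  rw [potential, potential, ← add_sum_erase _ _ (mem_univ j), ← add_sum_erase _ _ (mem_univ j),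
    hrest, add_right_comm, ← mul_add, ← sum_add_distrib]
  congr 2
  refine sum_congr rfl fun T _ => ?_
  rw [heq]
  split_ifs <;> ring

variable {I : Market n m}

theorem potential_truncate_mono (hI : I.Admissible) (k : ℕ) (ℓ : Fin n → Fin m → ℕ) {N N' : ℕ}
    (hN : N ≤ N') : potential k I.r (fun j => (I.q j).demand) (truncate ℓ N) ≤
      potential k I.r (fun j => (I.q j).demand) (truncate ℓ N') :=
  sum_le_sum fun j _ => mul_le_mul_of_nonneg_left
    (sum_le_sum fun T _ => hI.monotone_demand j _ _ (labelled_truncate_subset ℓ hN j T))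
    (I.r_nonneg j)

theorem potential_zero (k : ℕ) : potential k I.r (fun j => (I.q j).demand) 0 = 0 := by
  have : ∀ T, labelled (fun _ : Fin n => 0) T = ∅ := fun T => by ext; simp [mem_labelled]
  simp [potential, this, ChoiceSystem.demand_empty]

/-- The greedy gain is at least the average gain over the `k` groups of supplier `j`. In the sum
over the groups a set `T` occurs once per element, hence the weight `#T`. Replacing the truncated
labelling by the final one only lowers the marginal values. -/
theorem le_gain_of_isGreedyRow (hI : I.Admissible) (k : ℕ) {ℓ : Fin n → Fin m → ℕ} {i : Fin n}
    (hi : IsGreedyRow k I.r (fun j => (I.q j).demand) ℓ i) (j : Fin m) :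
    I.r j * ∑ T ∈ (range k).powerset, #T *
      ((I.q j).demand (insert i (labelled (ℓ · j) T)) - (I.q j).demand (labelled (ℓ · j) T)) ≤
    k * (potential k I.r (fun j => (I.q j).demand) (truncate ℓ (i + 1)) -
      potential k I.r (fun j => (I.q j).demand) (truncate ℓ i)) := by
  obtain ⟨j₀, t₀, _, hrow, hmax⟩ := hi
  set Q := fun j => (I.q j).demand
  set P := potential k I.r Q
  have hzero : truncate ℓ i i = 0 := by funext j; simp [truncate]
  have hsum : ∑ t ∈ range k, (P (Function.update (truncate ℓ i) i (Pi.single j (t + 1))) -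
      P (truncate ℓ i)) ≤ k * (P (truncate ℓ (i + 1)) - P (truncate ℓ i)) := by
    rw [truncate_succ, hrow]
    refine (sum_le_card_nsmul _ _ _ fun t ht =>
      sub_le_sub_right (hmax j t (mem_range.1 ht)) _).trans_eq ?_
    rw [card_range, nsmul_eq_mul]
  refine le_trans ?_ hsum
  have hgain : ∀ t, P (Function.update (truncate ℓ i) i (Pi.single j (t + 1))) -
      P (truncate ℓ i) = I.r j * ∑ T ∈ (range k).powerset, if t ∈ T then
        Q j (insert i (labelled (truncate ℓ i · j) T)) - Q j (labelled (truncate ℓ i · j) T)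
        else 0 := fun t => by
    rw [sub_eq_iff_eq_add']
    exact potential_update k I.r Q hzero j t
  rw [sum_congr rfl fun t _ => hgain t, ← mul_sum, sum_comm]
  refine mul_le_mul_of_nonneg_left (sum_le_sum fun T hT => ?_) (I.r_nonneg j)
  rw [sum_ite_mem, inter_eq_right.2 (mem_powerset.1 hT), sum_const, nsmul_eq_mul]
  refine mul_le_mul_of_nonneg_left ((hI.submodular_demand j).marginal_le (hI.monotone_demand j)
    ?_ i) (Nat.cast_nonneg _)
  have := labelled_truncate_subset ℓ (le_max_left (i : ℕ) n) j T
  rwa [truncate_of_le ℓ (le_max_right _ _)] at this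

/-- The greedy labelling against an arbitrary assignment of the assigned consumers. -/
theorem welfare_le_potential (hI : I.Admissible) (k : ℕ) {ℓ : Fin n → Fin m → ℕ}
    {c : Fin n → Option (Fin m)}
    (hℓ : ∀ i, c i ≠ none → IsGreedyRow k I.r (fun j => (I.q j).demand) ℓ i) :
    k * 2 ^ k * I.welfare (Market.pickers c) ≤
      (3 * k + 1) * potential k I.r (fun j => (I.q j).demand) ℓ := by
  set Q := fun j => (I.q j).demand with hQ
  set P := potential k I.r Q with hP
  set gain : Fin n → Fin m → ℝ := fun i j => I.r j * ∑ T ∈ (range k).powerset, #T *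
      (Q j (insert i (labelled (ℓ · j) T)) - Q j (labelled (ℓ · j) T)) with hgain
  -- The gains of the single consumers telescope to the final potential.
  have htel : ∑ i : Fin n, k * (P (truncate ℓ (i + 1)) - P (truncate ℓ i)) = k * P ℓ := by
    rw [← mul_sum, Fin.sum_univ_eq_sum_range fun N => P (truncate ℓ (N + 1)) - P (truncate ℓ N),
      sum_range_sub (fun N => P (truncate ℓ N)), truncate_of_le ℓ le_rfl]
    have : truncate ℓ 0 = 0 := by funext i j; simp [truncate]
    rw [this, hP, potential_zero, sub_zero]
  have hstep : ∑ j, ∑ i ∈ Market.pickers c j, gain i j ≤ k * P ℓ := by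
    simp only [Market.pickers, sum_filter]
    rw [← htel, sum_comm]
    refine sum_le_sum fun i _ => ?_
    -- A consumer that `c` leaves out need not be assigned greedily: its step does not decrease the
    -- potential.
    rcases hc : c i with _ | j
    · simpa using mul_nonneg (Nat.cast_nonneg k)
        (sub_nonneg.2 (potential_truncate_mono hI k ℓ (Nat.le_succ i)))
    · simpa using le_gain_of_isGreedyRow hI k (hℓ i (by simp [hc])) j
  -- Here ∑ #T = k 2^(k-1) is the coefficient of the competing demand, and the subtracted terms `#T
  -- * Q j (labelled …)` amount to at most (k+1)/2 times the share of `j` in the potential. With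
  -- `hstep` this becomes k 2^k w - (k+1) P ≤ 2 k P.
  have hlow : ∀ j, I.r j * (k * 2 ^ k * Q j (Market.pickers c j)) -
      (k + 1) * (I.r j * ∑ T ∈ (range k).powerset, Q j (labelled (ℓ · j) T)) ≤
      2 * ∑ i ∈ Market.pickers c j, gain i j := fun j => by
    simp only [hgain]
    rw [← mul_sum, sum_comm, mul_left_comm (2 : ℝ), mul_left_comm (k + 1 : ℝ),
      ← mul_sub]
    refine mul_le_mul_of_nonneg_left ?_ (I.r_nonneg j)
    have h1 : ∑ T ∈ (range k).powerset, #T *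
        (Q j (Market.pickers c j) - Q j (labelled (ℓ · j) T)) ≤
        ∑ T ∈ (range k).powerset, ∑ i ∈ Market.pickers c j, #T *
        (Q j (insert i (labelled (ℓ · j) T)) - Q j (labelled (ℓ · j) T)) := by
      refine sum_le_sum fun T _ => ?_
      rw [← mul_sum]
      exact mul_le_mul_of_nonneg_left ((hI.submodular_demand j).sub_le_sum_marginal
        (hI.monotone_demand j) _ _) (Nat.cast_nonneg _)
    simp only [mul_sub, sum_sub_distrib, ← sum_mul] at h1 ⊢
    have h2 := two_mul_sum_card (range k)
    have h3 := ((hI.submodular_demand j).labelled (hI.monotone_demand j)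
      (ℓ · j)).two_mul_sum_card_mul_le ((I.q j).demand_nonneg _) (range k)
    rw [card_range] at h2 h3
    have h4 : k * 2 ^ k * Q j (Market.pickers c j) =
        2 * ((∑ T ∈ (range k).powerset, (#T : ℝ)) * Q j (Market.pickers c j)) := by
      rw [← h2]; ring
    simp only [hQ] at *
    linarith
  have hsum := sum_le_sum fun j (_ : j ∈ univ) => hlow j
  rw [sum_sub_distrib, ← mul_sum, ← mul_sum] at hsum
  have hw : k * 2 ^ k * I.welfare (Market.pickers c) =
      ∑ j, I.r j * (k * 2 ^ k * Q j (Market.pickers c j)) := by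
    rw [Market.welfare, mul_sum]
    exact sum_congr rfl fun j _ => by ring
  have hPe : P ℓ = ∑ j, I.r j * ∑ T ∈ (range k).powerset, Q j (labelled (ℓ · j) T) := rfl
  rw [hw]
  rw [← hPe] at hsum
  linarith

/-- The guarantee of the greedy labelling with seven groups. -/
theorem greedy_guarantee (hI : I.Admissible) (C : Setting n) {ℓ : Fin n → Fin m → ℕ}
    (hℓ : ∀ i, (∃ j : Fin m, C.Allows i {j}) →
      IsGreedyRow 7 I.r (fun j => (I.q j).demand) ℓ i)
    {S : Fin n → Finset (Fin m)} (hS : ∀ i j, ℓ i j ≠ 0 → S i = {j}) :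
    (1 - Real.exp (-1)) / 2 * I.opt C ≤ I.expectedRevenue S := by
  -- Equivalent to (1 - 1/e)/2 ≤ 7/22, the value of k/(3k+1) at k = 7. The value 6/19 at k = 6 would
  -- be too small.
  have hexp : 4 / 11 ≤ Real.exp (-1) := by
    rw [Real.exp_neg, le_inv_comm₀ (by norm_num) (Real.exp_pos 1)]
    have := Real.exp_one_lt_d9
    norm_num
    linarith
  have hER := Market.sum_labelled_le_expectedRevenue hI 7 ℓ S hS
  have hopt : I.opt C ≤ 22 / 7 * I.expectedRevenue S := by
    refine I.opt_le fun S' hS' => I.expectedRevenue_le fun c hc => ?_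
    have := welfare_le_potential hI 7 (c := c) fun i hi => by
      obtain ⟨j, hj⟩ := Option.ne_none_iff_exists'.1 hi
      -- A supplier chosen from a feasible menu has a feasible singleton, so the greedy rule did
      -- assign `i`.
      refine hℓ i ⟨j, ?_⟩
      have hfi := hS' i
      cases C with
      | unconstrained => trivial
      | budget K => exact (card_le_card (singleton_subset_iff.2 (hc i j hj))).trans hfi
    rw [potential] at this
    push_cast at this
    linarith
  have h0 : 0 ≤ I.expectedRevenue S := by
    rw [Market.expectedRevenue_eq_sum]
    exact sum_nonneg fun c _ => mul_nonneg (prod_nonneg fun i _ => (I.p i).prob_nonneg _ _)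
      (I.welfare_nonneg _)
  have hexp1 : 0 < 1 - Real.exp (-1) := by
    have := Real.exp_lt_one_iff.2 (show (-1 : ℝ) < 0 by norm_num)
    linarith
  nlinarith [mul_le_mul_of_nonneg_left hopt hexp1.le]

end Greedy

/-! ## Deterministic executions -/

namespace Program

variable {n m : ℕ} {Q : Fin m → Finset (Fin n) → ℝ}

/-- The program `P`, started in `s`, tosses no coins, takes at most `c` steps, and ends in a memory
with the property `post`. -/
def Ensures (Q : Fin m → Finset (Fin n) → ℝ) (P : Program) (s : Memory) (c : ℕ)
    (post : Memory → Prop) : Prop :=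
  ∃ s' c', P.exec Q s = Coin.ret (s', c') ∧ c' ≤ c ∧ post s'

theorem Ensures.mono {P : Program} {s : Memory} {c c' : ℕ} {post post' : Memory → Prop}
    (h : P.Ensures Q s c post) (hc : c ≤ c') (hp : ∀ s', post s' → post' s') :
    P.Ensures Q s c' post' := by
  obtain ⟨s', d, he, hd, hs⟩ := h
  exact ⟨s', d, he, hd.trans hc, hp _ hs⟩

theorem ensures_skip {s : Memory} {post : Memory → Prop} (h : post s) :
    skip.Ensures Q s 1 post :=
  ⟨s, 1, rfl, le_rfl, h⟩

theorem size_le_self (v : ℕ) : Nat.size v ≤ v := Nat.size_le.2 Nat.lt_two_pow_self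

theorem ensures_setNat {a : ℕ} {k v : NatExpr} {s : Memory} {b : ℕ} {post : Memory → Prop}
    (hb : v.eval s ≤ b) (h : post (s.setNat a (k.eval s) (v.eval s))) :
    (setNat a k v).Ensures Q s (1 + b) post :=
  ⟨_, _, rfl, Nat.add_le_add_left ((size_le_self _).trans hb) 1, h⟩

theorem ensures_setReal {a : ℕ} {k : NatExpr} {v : RealExpr} {s : Memory} {post : Memory → Prop}
    (h : post (s.setReal a (k.eval s) (v.eval s))) : (setReal a k v).Ensures Q s 1 post :=
  ⟨_, _, rfl, le_rfl, h⟩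

theorem ensures_query {a : ℕ} {k j : NatExpr} {b : ℕ} {s : Memory} {post : Memory → Prop}
    (j₀ : Fin m) (hj : j.eval s = j₀)
    (h : post (s.setReal a (k.eval s) (Q j₀ (univ.filter fun i : Fin n => s.nat b i ≠ 0)))) :
    (query a k j b).Ensures Q s 1 post := by
  refine ⟨_, _, rfl, le_rfl, ?_⟩
  have hlt : j.eval s < m := hj ▸ j₀.2
  rw [dif_pos hlt, show (⟨j.eval s, hlt⟩ : Fin m) = j₀ from Fin.ext hj]
  convert h

theorem Ensures.seq {P₁ P₂ : Program} {s : Memory} {c₁ c₂ : ℕ} {post : Memory → Prop}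
    (h : P₁.Ensures Q s c₁ fun s₁ => P₂.Ensures Q s₁ c₂ post) :
    (seq P₁ P₂).Ensures Q s (c₁ + c₂) post := by
  obtain ⟨s₁, d₁, he₁, hd₁, s₂, d₂, he₂, hd₂, hp⟩ := h
  refine ⟨s₂, d₁ + d₂, ?_, add_le_add hd₁ hd₂, hp⟩
  rw [exec, he₁, Coin.bind, he₂, Coin.bind]

theorem ensures_cond {t : Test} {P₁ P₂ : Program} {s : Memory} {c : ℕ} {post : Memory → Prop}
    (h₁ : t.Holds s → P₁.Ensures Q s c post) (h₂ : ¬t.Holds s → P₂.Ensures Q s c post) :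
    (cond t P₁ P₂).Ensures Q s (c + 1) post := by
  by_cases ht : t.Holds s
  · obtain ⟨s', d, he, hd, hp⟩ := h₁ ht
    refine ⟨s', d + 1, ?_, Nat.succ_le_succ hd, hp⟩
    rw [exec, if_pos ht, he, Coin.bind]
  · obtain ⟨s', d, he, hd, hp⟩ := h₂ ht
    refine ⟨s', d + 1, ?_, Nat.succ_le_succ hd, hp⟩
    rw [exec, if_neg ht, he, Coin.bind]

/-- Loops, with an invariant. -/
theorem ensures_loop {x : ℕ} {b : NatExpr} {P : Program} {s : Memory} {c N X : ℕ}
    (Inv : ℕ → Memory → Prop) (hb : b.eval s = N) (hX : N < X) (h0 : Inv 0 s)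
    (hstep : ∀ K < N, ∀ s, Inv K s → P.Ensures Q (s.setNat x 0 K) c (Inv (K + 1))) :
    (loop x b P).Ensures Q s (X * (X + c)) (Inv N) := by
  -- A round costs at most 1 + K + c ≤ X + c, because K < N < X. The initial step is absorbed at the
  -- end by the slack between N and X.
  have key : ∀ K ≤ N, ∃ s' c', loopRun x (P.exec Q) s K = Coin.ret (s', c') ∧
      c' ≤ 1 + K * (X + c) ∧ Inv K s' := by
    intro K hK
    induction K with
    | zero => exact ⟨s, 1, rfl, by simp, h0⟩
    | succ K ih =>
      obtain ⟨s₁, d₁, he₁, hd₁, hi⟩ := ih (by omega)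
      obtain ⟨s₂, d₂, he₂, hd₂, hp⟩ := hstep K (by omega) s₁ hi
      refine ⟨s₂, d₁ + (1 + Nat.size K) + d₂, ?_, ?_, hp⟩
      · rw [loopRun, he₁, Coin.bind, he₂, Coin.bind]
      · have := size_le_self K
        rw [Nat.succ_mul]
        omega
  obtain ⟨s', c', he, hc, hp⟩ := key N le_rfl
  refine ⟨s', c', by rw [exec, hb, he], hc.trans ?_, hp⟩
  obtain ⟨Y, rfl⟩ : ∃ Y, X = N + 1 + Y := ⟨X - (N + 1), by omega⟩
  nlinarith [Nat.zero_le (Y * (N + 1 + Y + c))]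

/-- Sequential composition of a list of programs. -/
def seqList : List Program → Program
  | [] => skip
  | P :: L => seq P (seqList L)

end Program

/-- Outside of the arrays `a` of naturals and `b` of reals, `s'` agrees with `s`. -/
def Memory.AgreeOff (s s' : Memory) (a b : List ℕ) : Prop :=
  (∀ x, x ∉ a → s'.nat x = s.nat x) ∧ ∀ x, x ∉ b → s'.real x = s.real x

namespace Memory

theorem AgreeOff.refl (s : Memory) (a b : List ℕ) : s.AgreeOff s a b :=
  ⟨fun _ _ => rfl, fun _ _ => rfl⟩

theorem AgreeOff.trans {s s' s'' : Memory} {a b a' b' : List ℕ} (h : s.AgreeOff s' a b)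
    (h' : s'.AgreeOff s'' a' b') (ha : a ⊆ a') (hb : b ⊆ b') : s.AgreeOff s'' a' b' :=
  ⟨fun x hx => (h'.1 x hx).trans (h.1 x fun hx' => hx (ha hx')),
    fun x hx => (h'.2 x hx).trans (h.2 x fun hx' => hx (hb hx'))⟩

theorem AgreeOff.mono {s s' : Memory} {a b a' b' : List ℕ} (h : s.AgreeOff s' a b)
    (ha : a ⊆ a') (hb : b ⊆ b') : s.AgreeOff s' a' b' :=
  h.trans (AgreeOff.refl s' a' b') ha hb

theorem AgreeOff.setNat {s s' : Memory} {a b : List ℕ} (h : s.AgreeOff s' a b) {x : ℕ} (hx : x ∈ a)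
    (k v : ℕ) : s.AgreeOff (s'.setNat x k v) a b :=
  ⟨fun y hy => by
    rw [← h.1 y hy]
    exact Function.update_of_ne (fun hxy : y = x => hy (hxy ▸ hx)) _ _, h.2⟩

theorem AgreeOff.setReal {s s' : Memory} {a b : List ℕ} (h : s.AgreeOff s' a b) {x : ℕ}
    (hx : x ∈ b) (k : ℕ) (v : ℝ) : s.AgreeOff (s'.setReal x k v) a b :=
  ⟨h.1, fun y hy => by
    rw [← h.2 y hy]
    exact Function.update_of_ne (fun hxy : y = x => hy (hxy ▸ hx)) _ _⟩

@[simp] theorem setNat_real (s : Memory) (a k v : ℕ) : (s.setNat a k v).real = s.real := rfl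

@[simp] theorem setReal_nat (s : Memory) (a k : ℕ) (v : ℝ) : (s.setReal a k v).nat = s.nat := rfl

@[simp] theorem setNat_nat_self (s : Memory) (a k v : ℕ) :
    (s.setNat a k v).nat a = Function.update (s.nat a) k v := by simp [setNat]

@[simp] theorem setNat_nat_of_ne (s : Memory) {a b : ℕ} (k v : ℕ) (h : b ≠ a) :
    (s.setNat a k v).nat b = s.nat b := by simp [setNat, h]

@[simp] theorem setReal_real_self (s : Memory) (a k : ℕ) (v : ℝ) :
    (s.setReal a k v).real a = Function.update (s.real a) k v := by simp [setReal]

@[simp] theorem setReal_real_of_ne (s : Memory) {a b : ℕ} (k : ℕ) (v : ℝ) (h : b ≠ a) :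
    (s.setReal a k v).real b = s.real b := by simp [setReal, h]

end Memory

/-! ## The greedy program

Arrays of naturals: 2 holds the labelling and finally the output, 3 the set passed to the oracle,
4 the current consumer, 5 and 8 the supplier and the group that are tried for it, 7 and 10 the best
supplier and the best label so far, 6 and 9 the loop variables of the evaluation of the potential.
Arrays of reals: 1 holds the potential, 2 the answer of the oracle, 3 the best potential so far. -/

namespace GreedyProgram

open Program

variable {n m : ℕ} {Q : Fin m → Finset (Fin n) → ℝ}

/-- Cell 0 of an array of naturals. -/
def natVar (a : ℕ) : NatExpr := NatExpr.read a (NatExpr.const 0)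

/-- Cell 0 of an array of reals. -/
def realVar (a : ℕ) : RealExpr := RealExpr.read a (NatExpr.const 0)

/-- The number of suppliers. -/
def suppliers : NatExpr := NatExpr.read 0 (NatExpr.const 1)

/-- The cell of the pair of consumer `i` and supplier `j`. -/
def pairCell (i j : NatExpr) : NatExpr := NatExpr.add (NatExpr.mul i suppliers) j

/-- A product that vanishes if and only if `e` is one of the labels of `T`. -/
def missExpr (e : NatExpr) : List ℕ → NatExpr
  | [] => NatExpr.const 1
  -- One of the two truncated differences is zero, so their sum is the distance of `e` from `t + 1`.
  | t :: T => NatExpr.mul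
      (NatExpr.add (NatExpr.sub e (NatExpr.const (t + 1))) (NatExpr.sub (NatExpr.const (t + 1)) e))
      (missExpr e T)

/-- Indicator of the event that `e` is one of the labels of `T`. -/
def hitExpr (e : NatExpr) (T : List ℕ) : NatExpr := NatExpr.sub (NatExpr.const 1) (missExpr e T)

theorem missExpr_eval_eq_zero (e : NatExpr) (T : List ℕ) (s : Memory) :
    (missExpr e T).eval s = 0 ↔ ∃ t ∈ T, e.eval s = t + 1 := by
  induction T with
  | nil => simp [missExpr, NatExpr.eval]
  | cons t T ih =>
    simp only [missExpr, NatExpr.eval, Nat.mul_eq_zero, ih, List.mem_cons, exists_eq_or_imp]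
    refine or_congr_left ?_
    omega

theorem hitExpr_eval_ne_zero (e : NatExpr) (T : List ℕ) (s : Memory) :
    (hitExpr e T).eval s ≠ 0 ↔ ∃ t ∈ T, e.eval s = t + 1 := by
  rw [← missExpr_eval_eq_zero]
  simp only [hitExpr, NatExpr.eval]
  omega

theorem hitExpr_eval_le (e : NatExpr) (T : List ℕ) (s : Memory) : (hitExpr e T).eval s ≤ 1 :=
  Nat.sub_le _ _

/-- The labelling held by the memory. -/
def labelling (n m : ℕ) (s : Memory) : Fin n → Fin m → ℕ := fun i j => s.nat 2 (i * m + j)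

/-- Write into array 3 the set of consumers of supplier `natVar 9` with groups in `T`. -/
def fillSet (T : Finset ℕ) : Program :=
  loop 6 (natVar 0)
    (setNat 3 (natVar 6) (hitExpr (NatExpr.read 2 (pairCell (natVar 6) (natVar 9))) T.toList))

theorem fillSet_spec (T : Finset ℕ) {s : Memory} {X : ℕ} (hn : s.nat 0 0 = n) (hm : s.nat 0 1 = m)
    (hX : n < X) (j : Fin m) (hj : s.nat 9 0 = j) :
    (fillSet T).Ensures Q s (X * (X + 2)) fun s' => s.AgreeOff s' [3, 6] [] ∧
      (univ.filter fun i : Fin n => s'.nat 3 i ≠ 0) = labelled (labelling n m s · j) T := by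
  refine (ensures_loop (N := n) (fun K s' => s.AgreeOff s' [3, 6] [] ∧
    ∀ i < K, s'.nat 3 i ≠ 0 ↔ ∃ t ∈ T, s.nat 2 (i * m + j) = t + 1)
    (by simpa [natVar, NatExpr.eval] using hn) hX
    ⟨Memory.AgreeOff.refl _ _ _, by simp⟩ ?_).mono le_rfl ?_
  · rintro K hK s₁ ⟨ha, hi⟩
    refine ensures_setNat (hitExpr_eval_le _ _ _) ⟨?_, fun i hiK => ?_⟩
    · exact (ha.setNat (by simp) _ _).setNat (by simp) _ _
    · simp only [natVar, NatExpr.eval]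
      have h9 := ha.1 9 (by simp)
      have h2 := ha.1 2 (by simp)
      have h0 := ha.1 0 (by simp)
      by_cases hiK' : i = K
      · subst hiK'
        simp only [Memory.setNat_nat_self, Function.update_self, ne_eq]
        rw [← ne_eq, hitExpr_eval_ne_zero]
        simp [pairCell, suppliers, NatExpr.eval, h9, h2, h0, hm, hj]
      · have : i < K := by omega
        simp [hiK', ← hi i this]
  · rintro s' ⟨ha, hi⟩
    refine ⟨ha, ?_⟩
    ext i
    simp only [mem_filter, mem_univ, true_and, mem_labelled, labelling]
    exact hi i i.2

/-- Add the contribution of supplier `natVar 9` and the set of groups `T` to the potential. -/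
def addTerm (T : Finset ℕ) : Program :=
  seq (fillSet T) (seq (query 2 (NatExpr.const 0) (natVar 9) 3)
    (setReal 1 (NatExpr.const 0)
      (RealExpr.add (realVar 1) (RealExpr.mul (RealExpr.read 0 (natVar 9)) (realVar 2)))))

theorem addTerm_spec (T : Finset ℕ) {s : Memory} {X : ℕ} (hn : s.nat 0 0 = n) (hm : s.nat 0 1 = m)
    (hX : n < X) (j : Fin m) (hj : s.nat 9 0 = j) :
    (addTerm T).Ensures Q s (X * (X + 2) + (1 + 1)) fun s' => s.AgreeOff s' [3, 6] [1, 2] ∧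
      s'.real 1 0 = s.real 1 0 + s.real 0 j * Q j (labelled (labelling n m s · j) T) := by
  refine Ensures.seq ((fillSet_spec T hn hm hX j hj).mono le_rfl ?_)
  rintro s₁ ⟨ha, hset⟩
  have h9 : s₁.nat 9 0 = j := by rw [ha.1 9 (by simp), hj]
  refine Ensures.seq (ensures_query j (by simpa [natVar, NatExpr.eval] using h9)
    (ensures_setReal ⟨?_, ?_⟩))
  · exact ((ha.mono (by simp) (by simp)).setReal (by simp) _ _).setReal (by simp) _ _
  · rw [hset]
    simp [natVar, realVar, NatExpr.eval, RealExpr.eval, h9, ha.2]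

theorem addTerms_spec (L : List (Finset ℕ)) {s : Memory} {X : ℕ} (hn : s.nat 0 0 = n)
    (hm : s.nat 0 1 = m) (hX : n < X) (j : Fin m) (hj : s.nat 9 0 = j) :
    (seqList (L.map addTerm)).Ensures Q s (L.length * (X * (X + 2) + 2) + 1) fun s' =>
      s.AgreeOff s' [3, 6] [1, 2] ∧ s'.real 1 0 = s.real 1 0 +
        (L.map fun T => s.real 0 j * Q j (labelled (labelling n m s · j) T)).sum := by
  induction L generalizing s with
  | nil => exact (ensures_skip ⟨Memory.AgreeOff.refl _ _ _, by simp⟩).mono (by simp) fun _ h => h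
  | cons T L ih =>
    refine (Ensures.seq ((addTerm_spec T hn hm hX j hj).mono le_rfl ?_)).mono
      (c := (X * (X + 2) + (1 + 1)) + (L.length * (X * (X + 2) + 2) + 1)) ?_ fun _ h => h
    · rintro s₁ ⟨ha, hr⟩
      have h2 : labelling n m s₁ = labelling n m s := by
        funext i j; simp only [labelling, ha.1 2 (by simp)]
      refine (ih (by rw [ha.1 0 (by simp), hn]) (by rw [ha.1 0 (by simp), hm])
        (by rw [ha.1 9 (by simp), hj])).mono le_rfl ?_
      rintro s₂ ⟨ha₂, hr₂⟩
      refine ⟨ha.trans ha₂ (by simp) (by simp), ?_⟩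
      rw [hr₂, hr, h2, ha.2 0 (by simp), List.map_cons, List.sum_cons, add_assoc]
    · rw [List.length_cons, Nat.succ_mul]
      omega

/-- Evaluate the potential with `k` groups of the current labelling. -/
def evalPotential (k : ℕ) : Program :=
  seq (setReal 1 (NatExpr.const 0) (RealExpr.ofNat (NatExpr.const 0)))
    -- The `2 ^ k` sets of groups are unrolled into the program text, which is possible since `k`
    -- does not depend on the input.
    (loop 9 suppliers (seqList ((range k).powerset.toList.map addTerm)))

theorem sum_ite_lt_succ {K : ℕ} (hK : K < m) (f : Fin m → ℝ) :
    ∑ j : Fin m, (if (j : ℕ) < K + 1 then f j else 0) =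
      (∑ j : Fin m, if (j : ℕ) < K then f j else 0) + f ⟨K, hK⟩ := by
  rw [← Fintype.sum_ite_eq' (⟨K, hK⟩ : Fin m) f, ← sum_add_distrib]
  refine sum_congr rfl fun j _ => ?_
  rcases lt_trichotomy (j : ℕ) K with h | h | h
  · rw [if_pos (by omega), if_pos h, if_neg (by simp [Fin.ext_iff]; omega), add_zero]
  · rw [if_pos (by omega), if_neg (by omega), if_pos (Fin.ext h), zero_add]
  · rw [if_neg (by omega), if_neg (by omega), if_neg (by simp [Fin.ext_iff]; omega), add_zero]

/-- Bound on the number of steps of `evalPotential k`. -/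
def evalCost (k X : ℕ) : ℕ := 1 + X * (X + (2 ^ k * (X * (X + 2) + 2) + 1))

theorem evalPotential_spec (k : ℕ) {r : Fin m → ℝ} {s : Memory} {X : ℕ} (hn : s.nat 0 0 = n)
    (hm : s.nat 0 1 = m) (hr : ∀ j : Fin m, s.real 0 j = r j) (hX : n + m < X) :
    (evalPotential k).Ensures Q s (evalCost k X) fun s' =>
      s.AgreeOff s' [3, 6, 9] [1, 2] ∧ s'.real 1 0 = potential k r Q (labelling n m s) := by
  set f : Fin m → ℝ := fun j =>
    r j * ∑ T ∈ (range k).powerset, Q j (labelled (labelling n m s · j) T) with hf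
  refine Ensures.seq (ensures_setReal ((ensures_loop (fun K s' =>
    s.AgreeOff s' [3, 6, 9] [1, 2] ∧ s'.real 1 0 = ∑ j : Fin m, if (j : ℕ) < K then f j else 0)
    (N := m) (X := X) ?_ (by omega) ⟨?_, ?_⟩ ?_).mono le_rfl ?_))
  · simpa [suppliers, NatExpr.eval] using hm
  · exact (Memory.AgreeOff.refl _ _ _).setReal (by simp) _ _
  · simp [NatExpr.eval, RealExpr.eval]
  · rintro K hK s₁ ⟨ha, hs⟩
    have h2 : labelling n m (s₁.setNat 9 0 K) = labelling n m s := by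
      funext i j; simp [labelling, ha.1 2]
    refine (addTerms_spec _ (X := X) (by simp [ha.1 0, hn]) (by simp [ha.1 0, hm])
      (by omega) ⟨K, hK⟩ (by simp)).mono ?_ ?_
    · rw [length_toList, card_powerset, card_range]
    · rintro s₂ ⟨ha₂, hr₂⟩
      refine ⟨(ha.setNat (by simp) _ _).trans (ha₂.mono (by simp) (by simp)) (by simp)
        (by simp), ?_⟩
      rw [hr₂, sum_map_toList, sum_ite_lt_succ hK, h2, ← mul_sum]
      simp [hs, ha.2 0, ← hr, hf]
  · rintro s₁ ⟨ha, hs⟩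
    refine ⟨ha, ?_⟩
    rw [hs]
    simp [potential, hf]

/-- Try the supplier `natVar 5` and the group `natVar 8` for the consumer `natVar 4`. -/
def tryLabel (k : ℕ) : Program :=
  seq (setNat 2 (pairCell (natVar 4) (natVar 5)) (NatExpr.add (natVar 8) (NatExpr.const 1)))
    (seq (evalPotential k)
      (seq (cond (Test.realLe (realVar 1) (realVar 3)) skip
          (seq (setReal 3 (NatExpr.const 0) (realVar 1))
            (seq (setNat 7 (NatExpr.const 0) (natVar 5))
              (setNat 10 (NatExpr.const 0) (NatExpr.add (natVar 8) (NatExpr.const 1))))))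
        (setNat 2 (pairCell (natVar 4) (natVar 5)) (NatExpr.const 0))))

theorem pairIndex_inj {i i' j j' : ℕ} (hj : j < m) (hj' : j' < m)
    (h : i * m + j = i' * m + j') : i = i' ∧ j = j' := by
  have hm : 0 < m := by omega
  have h1 : (i * m + j) / m = i := by
    rw [add_comm, Nat.add_mul_div_right _ _ hm, Nat.div_eq_of_lt hj, zero_add]
  have h2 : (i' * m + j') / m = i' := by
    rw [add_comm, Nat.add_mul_div_right _ _ hm, Nat.div_eq_of_lt hj', zero_add]
  have hi : i = i' := by rw [← h1, ← h2, h]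
  subst hi
  exact ⟨rfl, by omega⟩

/-- As the row of `i` was zero, writing one cell amounts to replacing the whole row. -/
theorem labelling_setNat (s : Memory) (i : Fin n) (j : Fin m) (v : ℕ)
    (hi : labelling n m s i = 0) :
    labelling n m (s.setNat 2 (i * m + j) v) =
      Function.update (labelling n m s) i (Pi.single j v) := by
  funext i' j'
  simp only [labelling, Memory.setNat_nat_self]
  by_cases hi' : i' = i
  · subst hi'
    by_cases hj' : j' = j
    · subst hj'; simp
    · have : (j' : ℕ) ≠ j := fun h => hj' (Fin.ext h)
      rw [Function.update_of_ne (by omega)]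
      simpa [hj', labelling] using congrFun hi j'
  · rw [Function.update_of_ne hi', Function.update_of_ne
      fun h => hi' (Fin.ext (pairIndex_inj j'.2 j.2 h).1)]
    rfl

/-- Bound on the number of steps of `tryLabel k`. -/
def tryCost (k X : ℕ) : ℕ := (1 + k) + (evalCost k X + (((1 + ((1 + X) + (1 + k))) + 1) + (1 + 0)))

/-- Array 2 is not among the changed arrays: the tentative label is erased at the end, and the cell
was zero before. -/
theorem tryLabel_spec {k : ℕ} {r : Fin m → ℝ} {s : Memory} {X : ℕ} (hn : s.nat 0 0 = n)
    (hm : s.nat 0 1 = m) (hr : ∀ j : Fin m, s.real 0 j = r j) (hX : n + m < X) (i : Fin n)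
    (j : Fin m) {t : ℕ} (ht : t < k) (h4 : s.nat 4 0 = i) (h5 : s.nat 5 0 = j)
    (h8 : s.nat 8 0 = t) (hi : labelling n m s i = 0) {V : ℝ}
    (hV : V = potential k r Q (Function.update (labelling n m s) i (Pi.single j (t + 1)))) :
    (tryLabel k).Ensures Q s (tryCost k X) fun s' =>
      s.AgreeOff s' [3, 6, 7, 9, 10] [1, 2, 3] ∧
      ((V ≤ s.real 3 0 ∧ s'.real 3 0 = s.real 3 0 ∧ s'.nat 7 0 = s.nat 7 0 ∧
          s'.nat 10 0 = s.nat 10 0) ∨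
        (s.real 3 0 < V ∧ s'.real 3 0 = V ∧ s'.nat 7 0 = j ∧ s'.nat 10 0 = t + 1)) := by
  have hcell : ∀ s₁ : Memory, s₁.nat 4 0 = i → s₁.nat 5 0 = j → s₁.nat 0 1 = m →
      (pairCell (natVar 4) (natVar 5)).eval s₁ = i * m + j := fun s₁ h h' h'' => by
    simp [pairCell, natVar, suppliers, NatExpr.eval, h, h', h'']
  refine Ensures.seq (ensures_setNat (by simp [NatExpr.eval, natVar, h8]; omega) ?_)
  rw [hcell s h4 h5 hm, show (NatExpr.add (natVar 8) (NatExpr.const 1)).eval s = t + 1 by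
    simp [NatExpr.eval, natVar, h8]]
  refine Ensures.seq ((evalPotential_spec k (by simpa using hn) (by simpa using hm)
    (by simpa using hr) hX).mono le_rfl ?_)
  rw [labelling_setNat s i j _ hi, ← hV]
  rintro s₁ ⟨ha, hr₁⟩
  -- The final erasure, treated once for both branches of the comparison.
  have hreset : ∀ s₂ : Memory, s₁.AgreeOff s₂ [7, 10] [3] →
      ((V ≤ s.real 3 0 ∧ s₂.real 3 0 = s.real 3 0 ∧ s₂.nat 7 0 = s.nat 7 0 ∧
          s₂.nat 10 0 = s.nat 10 0) ∨
        (s.real 3 0 < V ∧ s₂.real 3 0 = V ∧ s₂.nat 7 0 = j ∧ s₂.nat 10 0 = t + 1)) →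
      (setNat 2 (pairCell (natVar 4) (natVar 5)) (NatExpr.const 0)).Ensures Q s₂ (1 + 0)
      fun s' => s.AgreeOff s' [3, 6, 7, 9, 10] [1, 2, 3] ∧
      ((V ≤ s.real 3 0 ∧ s'.real 3 0 = s.real 3 0 ∧ s'.nat 7 0 = s.nat 7 0 ∧
          s'.nat 10 0 = s.nat 10 0) ∨
        (s.real 3 0 < V ∧ s'.real 3 0 = V ∧ s'.nat 7 0 = j ∧ s'.nat 10 0 = t + 1)) := by
    intro s₂ ha₂ hres
    have ha' := (ha.mono (a' := [3, 6, 7, 9, 10]) (b' := [1, 2, 3]) (by simp) (by simp)).trans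
      (ha₂.mono (a' := [3, 6, 7, 9, 10]) (b' := [1, 2, 3]) (by simp) (by simp)) (by simp) (by simp)
    refine ensures_setNat (by simp [NatExpr.eval]) ⟨⟨fun x hx => ?_, fun x hx => ?_⟩, ?_⟩
    · rw [hcell s₂ (by simp [ha'.1 4, h4]) (by simp [ha'.1 5, h5]) (by simp [ha'.1 0, hm])]
      by_cases hx2 : x = 2
      · subst hx2
        have hz : s.nat 2 (i * m + j) = 0 := congrFun hi j
        simp [ha'.1 2, NatExpr.eval, ← hz]
      · rw [Memory.setNat_nat_of_ne _ _ _ hx2, ha'.1 x hx, Memory.setNat_nat_of_ne _ _ _ hx2]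
    · rw [Memory.setNat_real, ha'.2 x hx, Memory.setNat_real]
    · simpa using hres
  refine Ensures.seq (ensures_cond (fun hle => ?_) fun hle => ?_)
  · simp only [Test.Holds, realVar, RealExpr.eval, NatExpr.eval, hr₁, ha.2 3 (by simp)] at hle
    refine (ensures_skip ?_).mono (by omega) fun _ h => h
    refine hreset _ (Memory.AgreeOff.refl _ _ _) (Or.inl ⟨by simpa using hle, ?_, ?_, ?_⟩)
    · simp [ha.2 3]
    · simp [ha.1 7]
    · simp [ha.1 10]
  · simp only [Test.Holds, realVar, RealExpr.eval, NatExpr.eval, hr₁, ha.2 3 (by simp),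
      not_le] at hle
    refine Ensures.seq (ensures_setReal (Ensures.seq (ensures_setNat ?_ (ensures_setNat ?_
      (hreset _ ?_ (Or.inr ⟨by simpa using hle, ?_, ?_, ?_⟩))))))
    · simp only [natVar, NatExpr.eval, Memory.setReal_nat, ha.1 5 (by simp)]
      simp [h5]
      omega
    · simp [natVar, NatExpr.eval, ha.1 8, h8]
      omega
    · exact (((Memory.AgreeOff.refl _ _ _).setReal (by simp) _ _).setNat (by simp) _ _).setNat
        (by simp) _ _
    · simp [NatExpr.eval, RealExpr.eval, realVar, hr₁]
    · simp [natVar, NatExpr.eval, ha.1 5, h5]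
    · simp [natVar, NatExpr.eval, ha.1 8, h8]

end GreedyProgram

/-! ### Choice of the best label, correctness and running time of the program -/

namespace GreedyProgram

open Program

variable {n m : ℕ} {Q : Fin m → Finset (Fin n) → ℝ}

/-- Find a supplier and a group for the consumer `natVar 4` that maximize the potential. -/
def chooseLabel (k : ℕ) : Program :=
  loop 5 suppliers (loop 8 (NatExpr.const k) (tryLabel k))

/-- Assign the consumer `natVar 4`, if it may be shown a supplier. -/
def assignConsumer (k : ℕ) : Program :=
  -- Without budgets both sides are 0; with budgets the test says `1 ≤ K i`. So it covers both
  -- settings.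
  cond (Test.natLe (NatExpr.read 0 (NatExpr.const 2)) (NatExpr.read 1 (natVar 4)))
    -- The start value 0 - 1 lies below every potential, so the first trial is always accepted.
    (seq (setReal 3 (NatExpr.const 0)
        (RealExpr.sub (RealExpr.ofNat (NatExpr.const 0)) (RealExpr.ofNat (NatExpr.const 1))))
      (seq (setNat 10 (NatExpr.const 0) (NatExpr.const 0))
        (seq (chooseLabel k) (setNat 2 (pairCell (natVar 4) (natVar 7)) (natVar 10)))))
    skip

/-- Assign all consumers, one after the other. -/
def greedyProgram (k : ℕ) : Program := loop 4 (natVar 0) (assignConsumer k)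

/-- The memory holds the best of the tried suppliers and groups. -/
def HoldsBest (k : ℕ) (V : Fin m → ℕ → ℝ) (tried : Fin m → ℕ → Prop) (s : Memory) : Prop :=
  (∀ j t, t < k → tried j t → V j t ≤ s.real 3 0) ∧
    ((s.real 3 0 = -1 ∧ s.nat 10 0 = 0) ∨
      ∃ j t, t < k ∧ s.nat 7 0 = (j : Fin m) ∧ s.nat 10 0 = t + 1 ∧ s.real 3 0 = V j t)

/-- Bound on the number of steps of `chooseLabel k`. -/
def chooseCost (k X : ℕ) : ℕ := X * (X + (k + 1) * (k + 1 + tryCost k X))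

theorem chooseLabel_spec {k : ℕ} {r : Fin m → ℝ} {s : Memory} {X : ℕ} (hn : s.nat 0 0 = n)
    (hm : s.nat 0 1 = m) (hr : ∀ j : Fin m, s.real 0 j = r j) (hX : n + m < X) (i : Fin n)
    (h4 : s.nat 4 0 = i) (hi : labelling n m s i = 0) {V : Fin m → ℕ → ℝ}
    (hV : ∀ j t, V j t =
      potential k r Q (Function.update (labelling n m s) i (Pi.single j (t + 1))))
    (h3 : s.real 3 0 = -1) (h10 : s.nat 10 0 = 0) :
    (chooseLabel k).Ensures Q s (chooseCost k X) fun s' =>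
      s.AgreeOff s' [3, 5, 6, 7, 8, 9, 10] [1, 2, 3] ∧ HoldsBest k V (fun _ _ => True) s' := by
  refine (ensures_loop (N := m) (fun K s' =>
    s.AgreeOff s' [3, 5, 6, 7, 8, 9, 10] [1, 2, 3] ∧ HoldsBest k V (fun j _ => (j : ℕ) < K) s')
    (by simpa [suppliers, NatExpr.eval] using hm) (by omega)
    ⟨Memory.AgreeOff.refl _ _ _, by simp, Or.inl ⟨h3, h10⟩⟩ ?_).mono le_rfl ?_
  · rintro K hK s₁ ⟨ha₁, hb₁⟩
    -- The pairs tried so far are those that precede (K, K') lexicographically.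
    refine (ensures_loop (N := k) (fun K' s' =>
      s.AgreeOff s' [3, 5, 6, 7, 8, 9, 10] [1, 2, 3] ∧ s'.nat 5 0 = K ∧
      HoldsBest k V (fun j t => (j : ℕ) < K ∨ (j : ℕ) = K ∧ t < K') s')
      rfl (Nat.lt_succ_self k) ⟨ha₁.setNat (by simp) _ _, by simp, ?_, ?_⟩ ?_).mono le_rfl ?_
    · simpa using hb₁.1
    · simpa using hb₁.2
    · rintro t ht s₂ ⟨ha₂, h5, hle, hbest⟩
      have h2 : labelling n m (s₂.setNat 8 0 t) = labelling n m s := by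
        funext i' j'; simp [labelling, ha₂.1 2]
      refine (tryLabel_spec (r := r) (by simp [ha₂.1 0, hn]) (by simp [ha₂.1 0, hm])
        (by simpa [ha₂.2 0] using hr) hX i ⟨K, hK⟩ ht (by simp [ha₂.1 4, h4]) (by simp [h5])
        (by simp) (by rw [h2, hi]) (V := V ⟨K, hK⟩ t) (by rw [h2, hV])).mono le_rfl ?_
      rintro s₃ ⟨ha₃, hs₃⟩
      refine ⟨(ha₂.setNat (by simp) _ _).trans (ha₃.mono (by simp) (by simp)) (by simp) (by simp),
        by simp [ha₃.1 5, h5], ?_⟩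
      rw [Memory.setNat_real, Memory.setNat_nat_of_ne _ _ _ (by norm_num : 7 ≠ 8),
        Memory.setNat_nat_of_ne _ _ _ (by norm_num : 10 ≠ 8)] at hs₃
      rcases hs₃ with ⟨hV₁, h₃, h₇, h₁₀⟩ | ⟨hV₁, h₃, h₇, h₁₀⟩
      · refine ⟨fun j t' ht' hjt => ?_, ?_⟩
        · rw [h₃]
          rcases hjt with hj | ⟨hj, ht''⟩
          · exact hle j t' ht' (Or.inl hj)
          · rcases Nat.lt_succ_iff_lt_or_eq.1 ht'' with ht'' | rfl
            · exact hle j t' ht' (Or.inr ⟨hj, ht''⟩)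
            · rwa [show j = ⟨K, hK⟩ from Fin.ext hj]
        · rw [h₃, h₇, h₁₀]
          exact hbest
      · refine ⟨fun j t' ht' hjt => ?_, Or.inr ⟨⟨K, hK⟩, t, ht, h₇, h₁₀, h₃⟩⟩
        rw [h₃]
        rcases hjt with hj | ⟨hj, ht''⟩
        · exact (hle j t' ht' (Or.inl hj)).trans hV₁.le
        · rcases Nat.lt_succ_iff_lt_or_eq.1 ht'' with ht'' | rfl
          · exact (hle j t' ht' (Or.inr ⟨hj, ht''⟩)).trans hV₁.le
          · rw [show j = ⟨K, hK⟩ from Fin.ext hj]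
    · rintro s₂ ⟨ha₂, _, hle, hbest⟩
      refine ⟨ha₂, fun j t ht hj => hle j t ht ?_, hbest⟩
      rcases Nat.lt_succ_iff_lt_or_eq.1 hj with hj | hj
      · exact Or.inl hj
      · exact Or.inr ⟨hj, ht⟩
  · rintro s₁ ⟨ha₁, hle, hbest⟩
    exact ⟨ha₁, fun j t ht _ => hle j t ht j.2, hbest⟩

/-- Bound on the number of steps of `assignConsumer k`. -/
def assignCost (k X : ℕ) : ℕ := 1 + ((1 + 0) + (chooseCost k X + (1 + k))) + 1

/-- The memory holds the input. -/
def HoldsInput (n m : ℕ) (C : Setting n) (r : Fin m → ℝ) (s : Memory) : Prop :=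
  s.nat 0 0 = n ∧ s.nat 0 1 = m ∧ (∀ j : Fin m, s.real 0 j = r j) ∧
    ∀ (i : Fin n) (j : Fin m), s.nat 0 2 ≤ s.nat 1 i ↔ C.Allows i {j}

theorem HoldsInput.of_agreeOff {C : Setting n} {r : Fin m → ℝ} {s s' : Memory}
    (h : HoldsInput n m C r s) {a b : List ℕ} (ha : s.AgreeOff s' a b) (h0 : 0 ∉ a) (h1 : 1 ∉ a)
    (h2 : 0 ∉ b) : HoldsInput n m C r s' := by
  unfold HoldsInput
  rw [ha.1 0 h0, ha.1 1 h1, ha.2 0 h2]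
  exact h

theorem assignConsumer_spec {k : ℕ} (hk : 0 < k) {C : Setting n} {r : Fin m → ℝ} {s : Memory}
    {X : ℕ} (hs : HoldsInput n m C r s) (hP : ∀ ℓ, 0 ≤ potential k r Q ℓ)
    (hX : n + m < X) (i : Fin n) (h4 : s.nat 4 0 = i) (hi : labelling n m s i = 0) :
    (assignConsumer k).Ensures Q s (assignCost k X) fun s' =>
      s.AgreeOff s' [2, 3, 5, 6, 7, 8, 9, 10] [1, 2, 3] ∧
      ∃ ρ, labelling n m s' = Function.update (labelling n m s) i ρ ∧
        ((∃ j : Fin m, C.Allows i {j}) → ∃ j t, t < k ∧ ρ = Pi.single j (t + 1) ∧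
          ∀ j' t', t' < k →
            potential k r Q (Function.update (labelling n m s) i (Pi.single j' (t' + 1))) ≤
              potential k r Q (Function.update (labelling n m s) i (Pi.single j (t + 1)))) ∧
        ((¬∃ j : Fin m, C.Allows i {j}) → ρ = 0) := by
  obtain ⟨hn, hm, hr, hC⟩ := hs
  have htest : (Test.natLe (NatExpr.read 0 (NatExpr.const 2))
      (NatExpr.read 1 (natVar 4))).Holds s ↔ s.nat 0 2 ≤ s.nat 1 i := by
    simp only [Test.Holds, natVar, NatExpr.eval, h4]
  refine ensures_cond (fun ht => ?_) fun ht => ?_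
  · have hall := fun j => (hC i j).1 (htest.1 ht)
    set V : Fin m → ℕ → ℝ := fun j t =>
      potential k r Q (Function.update (labelling n m s) i (Pi.single j (t + 1))) with hV
    set s₀ := (s.setReal 3 0 (((0 : ℕ) : ℝ) - ((1 : ℕ) : ℝ))).setNat 10 0 0 with hs₀
    have h2₀ : labelling n m s₀ = labelling n m s := by
      funext i' j'; simp [labelling, hs₀]
    have hchoose := chooseLabel_spec (Q := Q) (k := k) (r := r) (V := V) (s := s₀)
      hn hm hr hX i
      h4 (by rw [h2₀, hi]) (fun j t => by rw [h2₀]) (by simp [hs₀])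
      (by simp [hs₀])
    refine Ensures.seq (ensures_setReal (Ensures.seq (ensures_setNat le_rfl (Ensures.seq
      (hchoose.mono le_rfl ?_)))))
    rintro s₁ ⟨ha₁, hle, hbest⟩
    have ha₀ : s.AgreeOff s₀ [10] [3] :=
      ((Memory.AgreeOff.refl _ _ _).setReal (by simp) _ _).setNat (by simp) _ _
    have ha : s.AgreeOff s₁ [2, 3, 5, 6, 7, 8, 9, 10] [1, 2, 3] :=
      ha₀.trans (ha₁.mono (by simp) (by simp)) (by simp) (by simp)
    have h2 : labelling n m s₁ = labelling n m s := by
      rw [← h2₀]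
      funext i' j'; simp [labelling, ha₁.1 2]
    -- Without suppliers the labelling has no entries, and only the cost of the last write matters.
    rcases Nat.eq_zero_or_pos m with rfl | hmpos
    · have h10 : s₁.nat 10 0 ≤ k := by
        rcases hbest with ⟨_, h⟩ | ⟨j, _⟩
        · omega
        · exact j.elim0
      exact ensures_setNat (by simpa [natVar, NatExpr.eval] using h10)
        ⟨ha.setNat (by simp) _ _, 0, Subsingleton.elim _ _, fun ⟨j, _⟩ => j.elim0, fun _ => rfl⟩
    -- The start value cannot have survived, since some nonnegative potential was tried.
    · rcases hbest with ⟨hneg, _⟩ | ⟨j, t, htk, h7, h10, h3⟩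
      · have h1 := hle ⟨0, hmpos⟩ 0 hk trivial
        have h2 := hP (Function.update (labelling n m s) i (Pi.single ⟨0, hmpos⟩ (0 + 1)))
        rw [hneg] at h1
        exact absurd (h2.trans h1) (by norm_num)
      · refine ensures_setNat (by simp [natVar, NatExpr.eval, h10]; omega)
          ⟨ha.setNat (by simp) _ _, Pi.single j (t + 1), ?_, fun _ => ⟨j, t, htk, rfl, ?_⟩,
            fun hno => (hno ⟨j, hall j⟩).elim⟩
        · have hcell : (pairCell (natVar 4) (natVar 7)).eval s₁ = i * m + j := by
            simp [pairCell, natVar, suppliers, NatExpr.eval, h7, ha.1 4, ha.1 0, h4, hm]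
          rw [hcell, show (natVar 10).eval s₁ = t + 1 by simp [natVar, NatExpr.eval, h10],
            labelling_setNat s₁ i j _ (by rw [h2, hi]), h2]
        · intro j' t' ht'
          have := hle j' t' ht' trivial
          rwa [h3] at this
  · refine (ensures_skip ⟨Memory.AgreeOff.refl _ _ _, 0, ?_, fun ⟨j, hj⟩ => ?_,
      fun _ => rfl⟩).mono (by omega) fun _ h => h
    · rw [← hi, Function.update_eq_self]
    · exact absurd (htest.2 ((hC i j).2 hj)) ht

theorem truncate_update (ℓ : Fin n → Fin m → ℕ) (i : Fin n) (ρ : Fin m → ℕ) {N : ℕ} (hN : N ≤ i) :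
    truncate (Function.update ℓ i ρ) N = truncate ℓ N := by
  funext i' j
  simp only [truncate]
  split_ifs with h
  · rw [Function.update_of_ne]
    rintro rfl
    omega
  · rfl

/-- Greediness of a row refers to this row and the earlier ones only, so it survives later
assignments. -/
theorem isGreedyRow_update {k : ℕ} {r : Fin m → ℝ} {ℓ : Fin n → Fin m → ℕ} {i i' : Fin n}
    (h : IsGreedyRow k r Q ℓ i) (hi : i < i') (ρ : Fin m → ℕ) :
    IsGreedyRow k r Q (Function.update ℓ i' ρ) i := by
  unfold IsGreedyRow
  rwa [Function.update_of_ne hi.ne, truncate_update ℓ i' ρ hi.le]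

theorem greedyProgram_spec {k : ℕ} (hk : 0 < k) {C : Setting n} {r : Fin m → ℝ} {s : Memory}
    {X : ℕ} (hs : HoldsInput n m C r s) (hP : ∀ ℓ, 0 ≤ potential k r Q ℓ)
    (hX : n + m < X) (h0 : labelling n m s = 0) :
    (greedyProgram k).Ensures Q s (X * (X + assignCost k X)) fun s' => ∀ i : Fin n,
      ((∃ j : Fin m, C.Allows i {j}) → IsGreedyRow k r Q (labelling n m s') i) ∧
      ((¬∃ j : Fin m, C.Allows i {j}) → labelling n m s' i = 0) := by
  refine (ensures_loop (N := n) (fun K s' =>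
    s.AgreeOff s' [2, 3, 4, 5, 6, 7, 8, 9, 10] [1, 2, 3] ∧
    (∀ i : Fin n, K ≤ i → labelling n m s' i = 0) ∧ ∀ i : Fin n, (i : ℕ) < K →
      ((∃ j : Fin m, C.Allows i {j}) → IsGreedyRow k r Q (labelling n m s') i) ∧
      ((¬∃ j : Fin m, C.Allows i {j}) → labelling n m s' i = 0))
    (by simpa [natVar, NatExpr.eval] using hs.1) (by omega)
    ⟨Memory.AgreeOff.refl _ _ _, fun i _ => by rw [h0]; rfl, fun i hi => by omega⟩ ?_).mono
    le_rfl fun s' ⟨_, _, h⟩ i => h i i.2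
  rintro K hK s₁ ⟨ha₁, hzero, hrow⟩
  have h2 : labelling n m (s₁.setNat 4 0 K) = labelling n m s₁ := by
    funext i' j'; simp [labelling]
  have ha₁' := ha₁.setNat (x := 4) (by simp) 0 K
  refine (assignConsumer_spec hk (hs.of_agreeOff ha₁' (by simp) (by simp) (by simp)) hP hX
    ⟨K, hK⟩ (by simp) (by rw [h2]; exact hzero _ le_rfl)).mono le_rfl ?_
  rintro s₂ ⟨ha₂, ρ, hρ, hgreedy, hno⟩
  rw [h2] at hρ hgreedy
  -- Before round `K` the memory holds exactly the truncated labelling, so the maximum found by the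
  -- program is the one in `IsGreedyRow`.
  have htr : truncate (labelling n m s₁) K = labelling n m s₁ := by
    funext i j
    simp only [truncate]
    split_ifs with hi
    · rfl
    · rw [hzero i (by omega)]; rfl
  refine ⟨ha₁'.trans (ha₂.mono (by simp) (by simp)) (by simp) (by simp), fun i hi => ?_,
    fun i hi => ?_⟩
  · rw [hρ, Function.update_of_ne (by rintro rfl; simp at hi), hzero i (by omega)]
  · rw [hρ]
    rcases Nat.lt_succ_iff_lt_or_eq.1 hi with hi | hi
    · refine ⟨fun h => isGreedyRow_update ((hrow i hi).1 h) (i' := ⟨K, hK⟩) hi ρ, fun h => ?_⟩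
      rw [Function.update_of_ne (by rintro rfl; simp at hi)]
      exact (hrow i hi).2 h
    · obtain rfl : i = ⟨K, hK⟩ := Fin.ext hi
      refine ⟨fun h => ?_, fun h => by rw [Function.update_self, hno h]⟩
      obtain ⟨j, t, htk, hj, hmax⟩ := hgreedy h
      refine ⟨j, t, htk, by rw [Function.update_self, hj], ?_⟩
      rw [truncate_update _ _ _ le_rfl, htr]
      exact hmax

/-- Evaluating the potential is cubic, and this is repeated for all suppliers and for all consumers,
hence degree five. After expansion, coefficients of the powers of `y` are compared. -/
theorem cost_le (y : ℕ) : (y + 1) * (y + 1 + assignCost 7 (y + 1)) ≤ 10000 * (y + 1) ^ 5 := by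
  simp only [assignCost, chooseCost, tryCost, evalCost]
  ring_nf
  have h1 := Nat.zero_le (y ^ 1)
  have h2 := Nat.zero_le (y ^ 2)
  have h3 := Nat.zero_le (y ^ 3)
  have h4 := Nat.zero_le (y ^ 4)
  have h5 := Nat.zero_le (y ^ 5)
  omega

theorem holdsInput_inputMemory (C : Setting n) (r : Fin m → ℝ) :
    HoldsInput n m C r (inputMemory C r) := by
  refine ⟨by simp [inputMemory], by simp [inputMemory], fun j => by simp [inputMemory],
    fun i j => ?_⟩
  cases C with
  | unconstrained => simp [inputMemory, Setting.Allows]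
  | budget K => simp [inputMemory, Setting.Allows]

/-- The greedy program with seven groups solves the market problem. -/
theorem greedyProgram_guarantee (I : Market n m) (hI : I.Admissible) (C : Setting n) :
    ((greedyProgram 7).run C I.r fun j => (I.q j).demand).Always (fun o =>
      o.2 ≤ 10000 * (n + m + 1) ^ 5 ∧ C.Feasible o.1 ∧
      ∀ i, (o.1 i).card ≤ 1 ∧ ((∃ j : Fin m, C.Allows i {j}) → (o.1 i).card = 1)) ∧
    (1 - Real.exp (-1)) / 2 * I.opt C ≤
      ((greedyProgram 7).run C I.r fun j => (I.q j).demand).expect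
        (fun o => I.expectedRevenue o.1) := by
  obtain ⟨s', c, he, hc, hs'⟩ := greedyProgram_spec (k := 7) (by norm_num)
    (holdsInput_inputMemory C I.r) (Q := fun j => (I.q j).demand) (X := n + m + 1)
    (fun ℓ => sum_nonneg fun j _ => mul_nonneg (I.r_nonneg j)
      (sum_nonneg fun T _ => (I.q j).demand_nonneg _)) (by omega)
    (by funext i j; simp [labelling, inputMemory])
  -- No coin is tossed, so `Always` and `expect` concern a single leaf.
  rw [Program.run, he, Coin.bind]
  simp only [Coin.Always, Coin.expect]
  -- Labels start at 1, so the table of labels is itself the output.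
  have hmenu : ∀ i j, labelling n m s' i j ≠ 0 → outputMenus n m s' i = {j} := by
    intro i j hij
    by_cases h : ∃ j : Fin m, C.Allows i {j}
    · obtain ⟨j₀, t, _, hrow, _⟩ := (hs' i).1 h
      have hj : ∀ j', labelling n m s' i j' ≠ 0 ↔ j' = j₀ := fun j' => by
        rw [hrow, Pi.single_apply]
        split_ifs with h' <;> simp [h']
      ext j'
      rw [mem_singleton, (hj j).1 hij, ← hj j']
      simp [outputMenus, labelling]
    · exact (hij (by rw [(hs' i).2 h]; rfl)).elim
  have hempty : ∀ i, (¬∃ j : Fin m, C.Allows i {j}) → outputMenus n m s' i = ∅ := by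
    intro i h
    ext j
    have : s'.nat 2 (i * m + j) = 0 := congrFun ((hs' i).2 h) j
    simp [outputMenus, this]
  have hsingle : ∀ i, (∃ j : Fin m, C.Allows i {j}) → ∃ j, outputMenus n m s' i = {j} := by
    intro i h
    obtain ⟨j₀, t, _, hrow, _⟩ := (hs' i).1 h
    exact ⟨j₀, hmenu i j₀ (by rw [hrow]; simp)⟩
  refine ⟨⟨hc.trans (cost_le _), fun i => ?_, fun i => ?_⟩,
    greedy_guarantee hI C (fun i h => (hs' i).1 h) hmenu⟩
  · by_cases h : ∃ j : Fin m, C.Allows i {j}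
    · obtain ⟨j, hj⟩ := hsingle i h
      obtain ⟨j', hj'⟩ := h
      simp only [hj]
      cases C with
      | unconstrained => trivial
      | budget K => simpa [Setting.Allows] using hj'
    · simp only [hempty i h]
      cases C <;> simp [Setting.Allows]
  · by_cases h : ∃ j : Fin m, C.Allows i {j}
    · obtain ⟨j, hj⟩ := hsingle i h
      simp [hj]
    · simp [hempty i h, h]

end GreedyProgram

/-! ## Tightness -/

/-- The random set misses `U` with probability `∏ e ∈ U, (1 - y e)`: expand `∏ e, (y e + (1 - y e))`
with the first summand deleted on `U`. -/
theorem multilinearExtension_one_sub_disjoint {ι : Type} [Fintype ι] [DecidableEq ι]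
    (U : Finset ι) (y : ι → ℝ) :
    multilinearExtension (fun B => if Disjoint B U then 0 else 1) y = 1 - ∏ e ∈ U, (1 - y e) := by
  have hprod : ∏ e ∈ U, (1 - y e) = ∑ B : Finset ι, if Disjoint B U then
      inclusionWeight y B else 0 := by
    calc _ = ∏ e, ((if e ∈ U then 0 else y e) + (1 - y e)) := by
          rw [← univ_inter U, ← prod_ite_mem]
          refine prod_congr rfl fun e _ => ?_
          split_ifs <;> simp_all
      _ = _ := by
          rw [← sum_prod_mul_prod_compl]
          refine sum_congr rfl fun B _ => ?_
          split_ifs with hB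
          · rw [inclusionWeight]
            congr 1
            exact prod_congr rfl fun e he => if_neg (Finset.disjoint_left.1 hB he)
          · obtain ⟨e, he, heU⟩ := Finset.not_disjoint_iff.1 hB
            have h0 : ∏ e ∈ B, (if e ∈ U then 0 else y e) = 0 := prod_eq_zero he (if_pos heU)
            rw [h0, zero_mul]
  refine eq_sub_of_add_eq ?_
  calc _ = ∑ B, inclusionWeight y B := by
        rw [hprod, multilinearExtension, ← sum_add_distrib]
        refine sum_congr rfl fun B _ => ?_
        split_ifs <;> simp
    _ = 1 := sum_inclusionWeight y

/-! ### Choice models of the tight market -/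

namespace ChoiceSystem

variable {E : Type} [Fintype E] [DecidableEq E]

/-- Choose uniformly from the menu. -/
def uniform (E : Type) [Fintype E] [DecidableEq E] : ChoiceSystem E where
  prob x S := match x with
    | none => if S = ∅ then 1 else 0
    | some e => if e ∈ S then (#S : ℝ)⁻¹ else 0
  prob_nonneg x S := by
    cases x
    · simp only; split_ifs <;> norm_num
    · simp only; split_ifs <;> positivity
  prob_of_notMem e S he := if_neg he
  prob_sum S := by
    rcases S.eq_empty_or_nonempty with rfl | hS
    · simp
    · have : (#S : ℝ) ≠ 0 := by simpa using hS.ne_empty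
      rw [if_neg hS.ne_empty, sum_congr rfl fun e he => if_pos he]
      simp [this]

theorem uniform_regular : (uniform E).Regular := by
  intro S S' hSS'
  refine ⟨?_, fun e he => ?_⟩
  · simp only [uniform]
    split_ifs with h h'
    · exact le_rfl
    · exact (h' (subset_empty.1 (h ▸ hSS'))).elim
    · norm_num
    · exact le_rfl
  · simp only [uniform, if_pos he, if_pos (hSS' he)]
    have : 0 < #S := card_pos.2 ⟨e, he⟩
    have := card_le_card hSS'
    gcongr

/-- Written with `univ` to match `multilinearExtension_one_sub_disjoint`. -/
theorem uniform_demand : (uniform E).demand = fun S => if Disjoint S univ then 0 else 1 := by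
  funext S
  have h := (uniform E).prob_sum S
  rw [demand]
  simp only [uniform] at h ⊢
  by_cases hS : S = ∅
  · subst hS; simp
  · rw [if_neg hS, zero_add] at h
    rw [h, if_neg]
    exact fun h => hS (disjoint_top.1 h)

/-- Take the favorite `e₀` if it is offered, and otherwise choose uniformly from the menu with
probability one half. -/
def favorite (e₀ : E) : ChoiceSystem E where
  prob x S := match x with
    | none => if e₀ ∈ S then 0 else if S = ∅ then 1 else 1 / 2
    | some e => if e₀ ∈ S then (if e = e₀ then 1 else 0) else
        if e ∈ S then (2 * #S : ℝ)⁻¹ else 0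
  prob_nonneg x S := by
    cases x
    · simp only; split_ifs <;> norm_num
    · simp only; split_ifs <;> positivity
  prob_of_notMem e S he := by
    simp only [if_neg he]
    split_ifs with h h'
    · exact (he (h' ▸ h)).elim
    · rfl
    · rfl
  prob_sum S := by
    by_cases h0 : e₀ ∈ S
    · simp [h0]
    · rcases S.eq_empty_or_nonempty with rfl | hS
      · simp
      · have : (#S : ℝ) ≠ 0 := by simpa using hS.ne_empty
        simp only [if_neg h0, if_neg hS.ne_empty]
        rw [sum_congr rfl fun e he => if_pos he, sum_const, nsmul_eq_mul]
        field_simp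
        norm_num

theorem favorite_regular (e₀ : E) : (favorite e₀).Regular := by
  intro S S' hSS'
  refine ⟨?_, fun e he => ?_⟩
  · by_cases h' : e₀ ∈ S'
    · simp only [favorite, if_pos h']
      split_ifs <;> norm_num
    · have h : e₀ ∉ S := fun h => h' (hSS' h)
      simp only [favorite, if_neg h, if_neg h']
      split_ifs with h1 h2
      · exact le_rfl
      · exact (h2 (subset_empty.1 (h1 ▸ hSS'))).elim
      · norm_num
      · exact le_rfl
  · by_cases h' : e₀ ∈ S'
    · by_cases hee : e = e₀
      · subst hee
        simp [favorite, he, h']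
      · have := (favorite e₀).prob_nonneg (some e) S
        simpa [favorite, h', hee] using this
    · have h : e₀ ∉ S := fun h => h' (hSS' h)
      simp only [favorite, if_neg h, if_neg h', if_pos he, if_pos (hSS' he)]
      have : 0 < #S := card_pos.2 ⟨e, he⟩
      have := card_le_card hSS'
      gcongr

theorem favorite_prob_singleton (e₀ e e' : E) : (favorite e₀).prob (some e) {e'} =
    if e = e' then (if e = e₀ then 1 else 1 / 2) else 0 := by
  simp only [favorite, mem_singleton, card_singleton]
  by_cases h : e = e'
  · subst h
    by_cases h' : e₀ = e
    · simp [h']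
    · simp [h', Ne.symm h']
  · by_cases h' : e₀ = e'
    · subst h'; simp [h]
    · simp [h, h']

theorem favorite_easyToMatch (e₀ : E) : (favorite e₀).EasyToMatch := by
  intro e
  have h := (favorite e₀).prob_sum {e}
  have h' := favorite_prob_singleton e₀ e e
  rw [sum_singleton] at h
  rw [if_pos rfl] at h'
  split_ifs at h' <;> linarith

end ChoiceSystem

theorem setMonotone_not_disjoint {ι : Type} [DecidableEq ι] (U : Finset ι) :
    SetMonotone fun B : Finset ι => if Disjoint B U then (0 : ℝ) else 1 := by
  intro A B hAB
  by_cases hB : Disjoint B U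
  · simp [hB, disjoint_of_subset_left hAB hB]
  · simp only [if_neg hB]
    split_ifs <;> norm_num

theorem setSubmodular_not_disjoint {ι : Type} [DecidableEq ι] (U : Finset ι) :
    SetSubmodular fun B : Finset ι => if Disjoint B U then (0 : ℝ) else 1 := by
  intro A B hAB e _
  have := setMonotone_not_disjoint U _ _ (subset_insert e A)
  by_cases hB : Disjoint B U
  · have hA := disjoint_of_subset_left hAB hB
    simp [hA, hB, disjoint_insert_left]
  · have hB' : ¬Disjoint (insert e B) U := fun h =>
      hB (disjoint_of_subset_left (subset_insert e B) h)
    simp only [if_neg hB, if_neg hB'] at this ⊢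
    linarith

/-- As many suppliers as consumers, of revenue one, each matched if anyone selects it; consumer `i`
surely selects supplier `i` if it can. -/
def tightMarket (n : ℕ) : Market n n where
  p i := ChoiceSystem.favorite i
  q _ := ChoiceSystem.uniform (Fin n)
  r _ := 1
  r_nonneg _ := zero_le_one

namespace tightMarket

open Market

variable {n : ℕ}

theorem admissible (n : ℕ) : (tightMarket n).Admissible where
  regular_consumers i := ChoiceSystem.favorite_regular i
  regular_suppliers _ := ChoiceSystem.uniform_regular
  easy_consumers i := ChoiceSystem.favorite_easyToMatch i
  monotone_demand _ := by
    simp only [tightMarket, ChoiceSystem.uniform_demand]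
    exact setMonotone_not_disjoint _
  submodular_demand _ := by
    simp only [tightMarket, ChoiceSystem.uniform_demand]
    exact setSubmodular_not_disjoint _

theorem welfare_eq (A : Fin n → Finset (Fin n)) :
    (tightMarket n).welfare A = ∑ j, if A j = ∅ then 0 else 1 := by
  have h : ∀ B : Finset (Fin n), Disjoint B univ ↔ B = ∅ := fun B => disjoint_top
  simp [welfare, tightMarket, ChoiceSystem.uniform_demand, h]

theorem expectedRevenue_eq (S : Fin n → Finset (Fin n)) : (tightMarket n).expectedRevenue S =
    ∑ j, (1 - ∏ i, (1 - (ChoiceSystem.favorite i).prob (some j) (S i))) := by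
  rw [Market.expectedRevenue_eq]
  simp only [tightMarket, ChoiceSystem.uniform_demand, multilinearExtension_one_sub_disjoint,
    one_mul]

theorem multilinear_eq : (tightMarket n).multilinear =
    fun y => ∑ j, (1 - ∏ i, (1 - y (i, j))) := by
  funext y
  have hcol : ∀ j, ∏ i, (1 - y (i, j)) = ∏ e ∈ univ ×ˢ {j}, (1 - y e) := fun j => by
    rw [prod_product]
    simp
  have hdis : ∀ (B : Finset (Fin n × Fin n)) j, Market.slice B j = ∅ ↔ Disjoint B (univ ×ˢ {j}) := by
    intro B j
    rw [Finset.disjoint_left, Finset.eq_empty_iff_forall_notMem]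
    simp only [Market.slice, mem_filter, mem_univ, true_and, mem_product, mem_singleton, Prod.forall]
    exact ⟨fun h a b hab hb => h a (hb ▸ hab), fun h a ha => h a j ha rfl⟩
  simp only [multilinear, welfare_eq, sum_mul]
  rw [sum_comm]
  refine sum_congr rfl fun j _ => ?_
  rw [hcol, ← multilinearExtension_one_sub_disjoint]
  simp only [hdis]
  rfl

/-- At a constant point all partial derivatives coincide. For `c ≤ 1` they are nonnegative, so every
direction of maximal total mass is optimal. -/
theorem fderiv_multilinear (c : ℝ) (w : Fin n × Fin n → ℝ) :
    fderiv ℝ (tightMarket n).multilinear (fun _ => c) w = (1 - c) ^ (n - 1) * ∑ e, w e := by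
  have h : HasFDerivAt (tightMarket n).multilinear
      (∑ j : Fin n, -∑ i : Fin n, (∏ i' ∈ univ.erase i, (1 - c)) •
        -ContinuousLinearMap.proj (R := ℝ) (φ := fun _ : Fin n × Fin n => ℝ) (i, j))
      (fun _ => c) := by
    rw [multilinear_eq]
    refine HasFDerivAt.fun_sum fun j _ => HasFDerivAt.const_sub ?_ _
    exact HasFDerivAt.finsetProd (g := fun i (y : Fin n × Fin n → ℝ) => 1 - y (i, j))
      (x := fun _ => c) fun i _ => (hasFDerivAt_apply _ _).const_sub _
  rw [h.fderiv, Fintype.sum_prod_type_right]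
  simp [prod_const, mul_sum, card_erase_of_mem]

theorem sum_le_of_mem_assignmentPolytope {m : ℕ} {w : Fin n × Fin m → ℝ}
    (hw : w ∈ assignmentPolytope n m) : ∑ e, w e ≤ n := by
  have hconv : Convex ℝ {w : Fin n × Fin m → ℝ | ∑ e, w e ≤ n} :=
    convex_halfSpace_le ⟨fun _ _ => sum_add_distrib, fun _ _ => (mul_sum _ _ _).symm⟩ _
  refine convexHull_min ?_ hconv hw
  rintro _ ⟨B, hB, rfl⟩
  have := card_eq_sum_card_fiberwise (s := B) (t := univ) (f := Prod.fst) fun _ _ => mem_univ _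
  have h2 : ∑ i : Fin n, #(B.filter fun e => e.1 = i) ≤ ∑ i : Fin n, 1 :=
    sum_le_sum fun i _ => hB i
  rw [← this] at h2
  have h3 : #B ≤ n := by simpa using h2
  simpa using h3

/-- It is the average of the `n` assignments that send all consumers to the same supplier. -/
theorem const_mem_assignmentPolytope (hn : 0 < n) :
    (fun _ => (1 / n : ℝ)) ∈ assignmentPolytope n n := by
  have hsum : (fun _ => (1 / n : ℝ)) = ∑ j : Fin n, (1 / n : ℝ) •
      fun e : Fin n × Fin n => if e ∈ (univ ×ˢ {j} : Finset (Fin n × Fin n)) then (1 : ℝ) else 0 := by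
    funext ⟨a, b⟩
    simp
  have hn' : (n : ℝ) ≠ 0 := by positivity
  rw [hsum]
  refine (convex_convexHull ℝ _).sum_mem (fun _ _ => by positivity) (by simp [hn']) fun j _ =>
    subset_convexHull ℝ _ ⟨_, fun i => ?_, rfl⟩
  rw [card_le_one]
  simp only [mem_filter, mem_product, mem_univ, mem_singleton, true_and, Prod.forall]
  rintro a b ⟨rfl, rfl⟩ a' b' ⟨rfl, rfl⟩
  rfl

/-- The uniform run of the continuous greedy algorithm. -/
def run (n T : ℕ) (t : ℕ) : Fin n × Fin n → ℝ := fun _ => t / T * (1 / n)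

theorem isContinuousGreedyRun (hn : 0 < n) {T : ℕ} (hT : 1 ≤ T) :
    (tightMarket n).IsContinuousGreedyRun T (run n T) := by
  refine ⟨by funext; simp [run], fun t ht => ⟨_, const_mem_assignmentPolytope hn,
    fun w hw => ?_, ?_⟩⟩
  · have hn1 : (1 : ℝ) ≤ n := by exact_mod_cast hn
    have hc : (t / T * (1 / n) : ℝ) ≤ 1 := by
      refine mul_le_one₀ ?_ (by positivity) ?_
      · rw [div_le_one (by positivity)]
        exact_mod_cast ht.le
      · rw [div_le_one (by positivity)]
        exact hn1
    unfold run
    rw [fderiv_multilinear, fderiv_multilinear]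
    refine mul_le_mul_of_nonneg_left ((sum_le_of_mem_assignmentPolytope hw).trans_eq ?_)
      (pow_nonneg (sub_nonneg.2 hc) _)
    have : (n : ℝ) ≠ 0 := by positivity
    simp [this]
  · funext e
    simp [run]
    ring

/-- The first `k` suppliers get one consumer each, except that supplier 0 gets all the rest. -/
def target (hn : 0 < n) {k : ℕ} (hk : k ≤ n) (i : Fin n) : Fin n :=
  -- The shift keeps consumer `i` away from its favorite `i`.
  if h : (i : ℕ) + 1 < k then ⟨i + 1, h.trans_le hk⟩ else ⟨0, hn⟩

/-- The partition into the consumers of each target. -/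
def partition (hn : 0 < n) {k : ℕ} (hk : k ≤ n) (j : Fin n) : Finset (Fin n) :=
  univ.filter fun i => target hn hk i = j

theorem target_val (hn : 0 < n) {k : ℕ} (hk : k ≤ n) (i : Fin n) :
    (target hn hk i : ℕ) = if (i : ℕ) + 1 < k then (i : ℕ) + 1 else 0 := by
  unfold target
  split_ifs <;> rfl

theorem mem_partition (hn : 0 < n) {k : ℕ} (hk : k ≤ n) (i j : Fin n) :
    i ∈ partition hn hk j ↔ target hn hk i = j := by
  simp [partition]

theorem isPartition (hn : 0 < n) {k : ℕ} (hk : k ≤ n) : IsPartition (partition hn hk) := by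
  refine ⟨fun j j' hjj' => ?_, fun i => ⟨target hn hk i, by simp [partition]⟩⟩
  rw [Finset.disjoint_left]
  intro i hi hi'
  simp only [partition, mem_filter, mem_univ, true_and] at hi hi'
  exact hjj' (hi.symm.trans hi')

theorem sum_ite_val_lt {k : ℕ} (hk : k ≤ n) (c : ℝ) :
    ∑ j : Fin n, (if (j : ℕ) < k then c else 0) = k * c := by
  rw [Fin.sum_univ_eq_sum_range (fun j => if j < k then c else 0), ← sum_filter]
  have : (range n).filter (· < k) = range k := by
    ext x; simp only [mem_filter, mem_range]; omega
  rw [this]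
  simp

theorem welfare_partition (hn : 0 < n) {k : ℕ} (hk : k ≤ n) (hk0 : 0 < k) :
    (tightMarket n).welfare (partition hn hk) = k := by
  rw [welfare_eq, ← mul_one (k : ℝ), ← sum_ite_val_lt hk]
  refine sum_congr rfl fun j _ => ?_
  have : partition hn hk j = ∅ ↔ ¬(j : ℕ) < k := by
    rw [Finset.eq_empty_iff_forall_notMem]
    simp only [mem_partition, Fin.ext_iff, target_val]
    constructor
    · intro h hj
      rcases Nat.eq_zero_or_pos (j : ℕ) with h0 | h0
      · refine h ⟨n - 1, by omega⟩ ?_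
        rw [if_neg (by simp; omega), h0]
      · refine h ⟨j - 1, by omega⟩ ?_
        rw [if_pos (by simp; omega)]
        simp; omega
    · intro hj i hi
      split_ifs at hi <;> omega
  by_cases hj : (j : ℕ) < k
  · rw [if_neg (by rw [this]; simpa using hj), if_pos hj]
  · rw [if_pos (this.2 hj), if_neg hj]

theorem expectedRevenue_partition_le (hn : 0 < n) {k : ℕ} (hk : k ≤ n) (hk0 : 0 < k) :
    (tightMarket n).expectedRevenue (menusOf (partition hn hk)) ≤ (k + 1) / 2 := by
  -- A supplier 0 < j < k is shown only to consumer j - 1, who accepts with probability 1/2;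
  -- supplier 0 counts at most 1, and suppliers from `k` on are shown to nobody.
  have hbound : ∀ j : Fin n, (1 - ∏ i, (1 - (ChoiceSystem.favorite i).prob (some j)
      (menusOf (partition hn hk) i))) ≤
      (if (j : ℕ) < k then 1 / 2 else 0) + if j = ⟨0, hn⟩ then 1 / 2 else 0 := by
    intro j
    have hmenu : ∀ i, menusOf (partition hn hk) i = {target hn hk i} := fun i =>
      menusOf_eq_singleton (isPartition hn hk) ((mem_partition hn hk _ _).2 rfl)
    simp only [hmenu]
    rcases Nat.eq_zero_or_pos (j : ℕ) with h0 | h0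
    · have : j = ⟨0, hn⟩ := Fin.ext h0
      rw [if_pos (by omega), if_pos this]
      have : 0 ≤ ∏ i, (1 - (ChoiceSystem.favorite i).prob (some j) {target hn hk i}) :=
        prod_nonneg fun i _ => sub_nonneg.2 (ChoiceSystem.prob_le_one _ _ _)
      linarith
    · rw [if_neg (c := j = ⟨0, hn⟩) (by simp [Fin.ext_iff]; omega), add_zero]
      simp only [ChoiceSystem.favorite_prob_singleton]
      split_ifs with hj
      · rw [prod_eq_single ⟨j - 1, by omega⟩]
        · rw [if_pos, if_neg]
          · norm_num
          · simp [Fin.ext_iff]; omega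
          · rw [Fin.ext_iff, target_val, if_pos (by simp; omega)]
            simp; omega
        · intro i _ hi
          rw [if_neg, sub_zero]
          rw [Fin.ext_iff, target_val]
          rw [ne_eq, Fin.ext_iff] at hi
          simp only at hi
          split_ifs <;> omega
        · simp
      · rw [prod_eq_one, sub_self]
        intro i _
        rw [if_neg, sub_zero]
        rw [Fin.ext_iff, target_val]
        split_ifs <;> omega
  rw [expectedRevenue_eq]
  refine (sum_le_sum fun j _ => hbound j).trans_eq ?_
  rw [sum_add_distrib, sum_ite_val_lt hk, Fintype.sum_ite_eq']
  ring

/-- Showing every consumer its favorite matches all suppliers with certainty. -/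
theorem le_opt {C : Setting n} (hC : ∀ i j : Fin n, C.Allows i {j}) :
    n ≤ (tightMarket n).opt C := by
  refine le_trans ?_ ((tightMarket n).le_opt (S := fun i => {i}) fun i => hC i i)
  rw [expectedRevenue_eq]
  refine le_of_eq ?_
  rw [sum_congr rfl fun j _ => by
    rw [prod_eq_zero (mem_univ j) (by simp [ChoiceSystem.favorite_prob_singleton])]]
  simp

theorem welfareOpt_le (n : ℕ) : (tightMarket n).welfareOpt ≤ n := by
  refine Market.welfareOpt_le _ (Nat.cast_nonneg n) fun A _ => ?_
  rw [welfare_eq]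
  refine (sum_le_sum fun j _ => ?_).trans_eq (b := ∑ _j : Fin n, (1 : ℝ)) (by simp)
  split_ifs <;> norm_num

end tightMarket

/-- Since OPT and OPT_w are both at least n, comparing the revenue with n settles both tightness
claims at once. -/
theorem exists_tight_market {ε : ℝ} (hε : 0 < ε) : ∃ (n : ℕ) (I : Market n n), I.Admissible ∧
    (∀ C : Setting n, (∀ i j : Fin n, C.Allows i {j}) → n ≤ I.opt C) ∧ n ≤ I.welfareOpt ∧
    ∀ T : ℕ, 1 ≤ T → ∃ (y : ℕ → Fin n × Fin n → ℝ) (A : Fin n → Finset (Fin n)),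
      I.IsGreedyPartition T y A ∧ I.multilinear (y T) ≤ I.welfare A ∧
      I.expectedRevenue (Market.menusOf A) < ((1 - Real.exp (-1)) / 2 + ε) * n := by
  have hlim : Filter.Tendsto (fun n : ℕ => (1 + (-1 : ℝ) / n) ^ n) Filter.atTop
      (nhds (Real.exp (-1))) := Real.tendsto_one_add_div_pow_exp (-1)
  have hev := (hlim.eventually (lt_mem_nhds (show Real.exp (-1) - ε < Real.exp (-1) by linarith))).and
    (Filter.eventually_ge_atTop (⌈2 / ε⌉₊ + 1))
  obtain ⟨n, hn1, hn2⟩ := hev.exists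
  have hn : 0 < n := by omega
  have hnR : (1 : ℝ) ≤ n := by exact_mod_cast hn
  -- This margin pays for rounding F up and for supplier 0: (k + 1)/2 < F/2 + 1.
  have hnε : 2 < ε * n := by
    have h1 : (⌈2 / ε⌉₊ : ℝ) + 1 ≤ n := by exact_mod_cast hn2
    have h2 := Nat.le_ceil (2 / ε)
    rw [mul_comm, ← div_lt_iff₀ hε]
    linarith
  have hpow : (1 + (-1 : ℝ) / n) ^ n = (1 - 1 / n) ^ n := by
    congr 1; ring
  rw [hpow] at hn1
  set F : ℝ := n * (1 - (1 - 1 / n) ^ n) with hF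
  have hbase0 : (0 : ℝ) ≤ 1 - 1 / n := sub_nonneg.2 ((div_le_one (by positivity)).2 hnR)
  have hbase1 : (1 - 1 / n : ℝ) < 1 := by
    have : (0 : ℝ) < 1 / n := by positivity
    linarith
  have hFpos : 0 < F := mul_pos (by positivity) (sub_pos.2 (pow_lt_one₀ hbase0 hbase1 hn.ne'))
  have hFle : F ≤ n := by
    have := pow_nonneg hbase0 n
    nlinarith
  -- F is the multilinear extension at the end of the run, so k parts are the fewest for which the
  -- rounding loses nothing.
  set k := ⌈F⌉₊
  have hk : k ≤ n := Nat.ceil_le.2 hFle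
  have hk0 : 0 < k := Nat.ceil_pos.2 hFpos
  have hFk : F ≤ k := Nat.le_ceil F
  have hkF : (k : ℝ) < F + 1 := Nat.ceil_lt_add_one hFpos.le
  -- It gives F ≥ (1 - 1/e) n, hence the welfare required of an output.
  have hexp : (1 - 1 / n : ℝ) ^ n ≤ Real.exp (-1) := Real.one_sub_div_pow_le_exp_neg hnR
  have hopt : ∀ C : Setting n, (∀ i j : Fin n, C.Allows i {j}) → n ≤ (tightMarket n).opt C :=
    fun C => tightMarket.le_opt
  have hpart := tightMarket.isPartition hn hk
  refine ⟨n, tightMarket n, tightMarket.admissible n, hopt,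
    (hopt Setting.unconstrained fun _ _ => trivial).trans
      (Market.opt_le_welfareOpt (tightMarket.admissible n) hpart _), fun T hT =>
    ⟨tightMarket.run n T, tightMarket.partition hn hk,
      ⟨tightMarket.isContinuousGreedyRun hn hT, ⟨hpart, fun i j _ => ?_⟩, ?_⟩, ?_, ?_⟩⟩
  · unfold tightMarket.run
    positivity
  · rw [tightMarket.welfare_partition hn hk hk0]
    have h1 : Real.exp (-1) < 1 := Real.exp_lt_one_iff.2 (by norm_num)
    have h2 := mul_le_mul_of_nonneg_left (tightMarket.welfareOpt_le n) (sub_nonneg.2 h1.le)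
    nlinarith
  · rw [tightMarket.welfare_partition hn hk hk0, tightMarket.multilinear_eq]
    refine le_trans (le_of_eq ?_) hFk
    have hT' : (T : ℝ) ≠ 0 := by positivity
    simp [tightMarket.run, hT', hF]
    ring
  · refine (tightMarket.expectedRevenue_partition_le hn hk hk0).trans_lt ?_
    have hneg : (n : ℝ) * (Real.exp (-1) - (1 - 1 / n) ^ n) ≤ n * ε :=
      mul_le_mul_of_nonneg_left (by linarith) (by positivity)
    nlinarith

end

theorem theorem1 :
    -- a randomized polynomial time algorithm that outputs singletons, with its guarantee
    (∃ (P : Program) (a b : ℕ), ∀ (n m : ℕ) (I : Market n m), I.Admissible →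
      ∀ C : Setting n,
        (P.run C I.r fun j => (I.q j).demand).Always (fun o =>
          o.2 ≤ a * (n + m + 1) ^ b ∧ C.Feasible o.1 ∧
          ∀ i, (o.1 i).card ≤ 1 ∧
            ((∃ j : Fin m, C.Allows i {j}) → (o.1 i).card = 1)) ∧
        (1 - Real.exp (-1)) / 2 * I.opt C ≤
          (P.run C I.r fun j => (I.q j).demand).expect (fun o => I.expectedRevenue o.1)) ∧
    -- every output of the continuous greedy approach has this guarantee
    (∀ (n m : ℕ) (I : Market n m), I.Admissible →
      ∀ (T : ℕ) (y : ℕ → Fin n × Fin m → ℝ) (A : Fin m → Finset (Fin n)),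
        I.IsGreedyPartition T y A →
        ∀ C : Setting n, (∀ (i : Fin n) (j : Fin m), C.Allows i {j}) →
          C.Feasible (Market.menusOf A) ∧
          (1 - Real.exp (-1)) / 2 * I.opt C ≤ I.expectedRevenue (Market.menusOf A)) ∧
    -- the guarantee is tight for this approach, in both settings
    (∀ ε : ℝ, 0 < ε → ∃ (n m : ℕ) (I : Market n m), I.Admissible ∧
      ∀ T : ℕ, 1 ≤ T → ∃ (y : ℕ → Fin n × Fin m → ℝ) (A : Fin m → Finset (Fin n)),
        I.IsGreedyPartition T y A ∧
        ∀ C : Setting n, (∀ (i : Fin n) (j : Fin m), C.Allows i {j}) →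
          I.expectedRevenue (Market.menusOf A) <
            ((1 - Real.exp (-1)) / 2 + ε) * I.opt C) ∧
    -- and, relative to the welfare bound, even with roundings that do not lose any value
    (∀ ε : ℝ, 0 < ε → ∃ (n m : ℕ) (I : Market n m), I.Admissible ∧
      ∀ T : ℕ, 1 ≤ T → ∃ (y : ℕ → Fin n × Fin m → ℝ) (A : Fin m → Finset (Fin n)),
        I.IsGreedyPartition T y A ∧ I.multilinear (y T) ≤ I.welfare A ∧
        I.expectedRevenue (Market.menusOf A) <
          ((1 - Real.exp (-1)) / 2 + ε) * I.welfareOpt) := by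
  refine ⟨⟨GreedyProgram.greedyProgram 7, 10000, 5, fun n m I hI C =>
    GreedyProgram.greedyProgram_guarantee I hI C⟩, fun n m I hI T y A hA C hC =>
      Market.greedyPartition_guarantee hI hA.2.1.1 hA.2.2 C hC, fun ε hε => ?_, fun ε hε => ?_⟩
  all_goals
    obtain ⟨n, I, hI, hopt, hwelfare, hrun⟩ := exists_tight_market hε
    have hα : 0 ≤ (1 - Real.exp (-1)) / 2 + ε := by
      have := Real.exp_lt_one_iff.2 (show (-1 : ℝ) < 0 by norm_num)
      linarith
    refine ⟨n, n, I, hI, fun T hT => ?_⟩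
    obtain ⟨y, A, hA, hle, hlt⟩ := hrun T hT
  · exact ⟨y, A, hA, fun C hC => hlt.trans_le (mul_le_mul_of_nonneg_left (hopt C hC) hα)⟩
  · exact ⟨y, A, hA, hle, hlt.trans_le (mul_le_mul_of_nonneg_left hwelfare hα)⟩
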